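/- **Theorem (The limiting roots).** For a finite abstract simplicial complex $G$ (a finite set of non-empty finite sets closed under passing to non-empty subsets) let $|G|$ be its number of simplices, let $L=L(G)$ be its connection Laplacian, the $|G|\times|G|$ matrix with $L(x,y)=1$ if the simplices $x,y$ intersect and $L(x,y)=0$ otherwise, and let $\zeta_G(s)=\sum_k \lambda_k^{-s}$, where $\lambda_k$ runs over the eigenvalues of $L^2$, counted with multiplicity. The Barycentric refinement of $G$ is the complex of non-empty cliques of the graph whose vertices are the simplices of $G$, two different simplices being adjacent if one contains the other. Put $G_0=G$, and let $G_{n+1}$ be the Barycentric refinement of $G_n$. For an analytic function $f\not\equiv 0$ on $\mathbb{C}$ let $\mu_f=\sum_{f(w)=0}\operatorname{ord}_w(f)\,\delta_w$ be its zero-locus measure. With $f_\pm(y)=\frac{y\pm\sqrt{y^2+4}}{2}$ define $$ z(s)=\frac12\int_0^1 \Big[\big(f_+(4\sin^2(\pi x))^2\big)^s+\big(f_-(4\sin^2(\pi x))^2\big)^s\Big]\,dx ,\qquad s\in\mathbb{C}. $$ Let $G$ be $1$-dimensional, that is, all simplices of $G$ have at most two elements and at least one has exactly two. Then: 1. $z$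 is entire, and $\zeta_{G_n}(s)/|G_n|\to z(s)$ as $n\to\infty$, uniformly on every compact subset of $\mathbb{C}$. 2. The roots of $\zeta_{G_n}$ converge weakly to the roots of $z$: $\int\varphi\,d\mu_{\zeta_{G_n}}\to\int\varphi\,d\mu_z$ for every continuous $\varphi:\mathbb{C}\to\mathbb{R}$ with compact support; for every compact $K\subset\mathbb{C}$ whose boundary contains no root of $z$, the restrictions of $\mu_{\zeta_{G_n}}$ to $K$ converge weakly to the restriction of $\mu_z$ to $K$; and for every compact $K$ that contains no root of $z$, $\mu_{\zeta_{G_n}}(K)=0$ for all sufficiently large $n$. -/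

import Mathlib

open Filter Topology MeasureTheory
open scoped ENNReal

universe u

/-- A finite abstract simplicial complex: a finite set of non-empty finite sets, closed under
passing to non-empty subsets. -/
structure FiniteComplex : Type (u + 1) where
  /-- the type from which the vertices are taken -/
  V : Type u
  /-- the underlying abstract simplicial complex -/
  complex : PreAbstractSimplicialComplex V
  /-- there are only finitely many simplices -/
  finite_faces : complex.faces.Finite

namespace FiniteComplex

/-- The type of simplices of `G`. -/
abbrev Simplex (G : FiniteComplex.{u}) : Type u := {x : Finset G.V // x ∈ G.complex.faces}

noncomputable instance (G : FiniteComplex.{u}) : Fintype G.Simplex :=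
  G.finite_faces.fintype

noncomputable instance (G : FiniteComplex.{u}) : DecidableEq G.Simplex :=
  Classical.decEq _

/-- `|G|`, the number of simplices of `G`. -/
noncomputable def size (G : FiniteComplex.{u}) : ℕ := Fintype.card G.Simplex

/-- `G` is `1`-dimensional: all simplices have at most two vertices, and some simplex has exactly
two. -/
def IsOneDimensional (G : FiniteComplex.{u}) : Prop :=
  (∀ x ∈ G.complex.faces, x.card ≤ 2) ∧ ∃ x ∈ G.complex.faces, x.card = 2

/-- The Whitney complex (clique complex) of a finite simple graph. -/
def whitney {W : Type u} [Finite W] (Γ : SimpleGraph W) : FiniteComplex.{u} where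
  V := W
  complex :=
    { faces := {c | c.Nonempty ∧ Γ.IsClique (c : Set W)}
      isRelLowerSet_faces := fun _ hc =>
        ⟨hc.1, fun _ hbc hb => ⟨hb, hc.2.subset (Finset.coe_subset.mpr hbc)⟩⟩ }
  finite_faces := Set.toFinite _

/-- The graph whose vertices are the simplices of `G`, two different simplices being adjacent
if one is contained in the other. -/
def inclusionGraph (G : FiniteComplex.{u}) : SimpleGraph G.Simplex :=
  SimpleGraph.fromRel fun x y => x.1 ⊆ y.1

/-- The Barycentric refinement of `G`. -/
def refine (G : FiniteComplex.{u}) : FiniteComplex.{u} := whitney G.inclusionGraph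

/-- The `n`-th Barycentric refinement `G_n` of `G = G_0`. -/
def refinement (G : FiniteComplex.{u}) (n : ℕ) : FiniteComplex.{u} := refine^[n] G

open Classical in
/-- The connection Laplacian: `L(x, y) = 1` if the simplices `x`, `y` intersect, and `0` else. -/
noncomputable def connectionLaplacian (G : FiniteComplex.{u}) :
    Matrix G.Simplex G.Simplex ℝ :=
  Matrix.of fun x y => if (x.1 ∩ y.1).Nonempty then 1 else 0

theorem isHermitian_connectionLaplacian_sq (G : FiniteComplex.{u}) :
    (G.connectionLaplacian ^ 2).IsHermitian := by
  refine Matrix.IsHermitian.pow ?_ 2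
  ext x y
  simp [connectionLaplacian, Finset.inter_comm]

/-- The connection zeta function `ζ_G(s) = ∑ λ^{-s}`, summed over the eigenvalues `λ` of `L²`,
with multiplicity. -/
noncomputable def zeta (G : FiniteComplex.{u}) (s : ℂ) : ℂ :=
  ∑ k, ((G.isHermitian_connectionLaplacian_sq.eigenvalues k : ℝ) : ℂ) ^ (-s)

end FiniteComplex

/-- The positive solution `x` of `x - 1/x = y`. -/
noncomputable def fPlus (y : ℝ) : ℝ := (y + √(y ^ 2 + 4)) / 2

/-- The negative solution `x` of `x - 1/x = y`. -/
noncomputable def fMinus (y : ℝ) : ℝ := (y - √(y ^ 2 + 4)) / 2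

/-- `Z(x, s) = (f₊(4 sin²(πx))²)^s + (f₋(4 sin²(πx))²)^s`. -/
noncomputable def bigZ (x : ℝ) (s : ℂ) : ℂ :=
  ((fPlus (4 * Real.sin (Real.pi * x) ^ 2) ^ 2 : ℝ) : ℂ) ^ s +
    ((fMinus (4 * Real.sin (Real.pi * x) ^ 2) ^ 2 : ℝ) : ℂ) ^ s

/-- The limiting zeta function. The factor `1/2` is there because a circular complex with `n`
vertices has `2n` simplices. -/
noncomputable def limitZeta (s : ℂ) : ℂ := (1 / 2 : ℂ) * ∫ x in (0 : ℝ)..1, bigZ x s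

/-- The zero-locus measure of an analytic function `f`: the sum of the Dirac masses at the roots
of `f`, every root counted with its multiplicity. -/
noncomputable def zeroLocusMeasure (f : ℂ → ℂ) : Measure ℂ :=
  Measure.sum fun w : {w : ℂ // f w = 0} =>
    ((analyticOrderAt f (w : ℂ) : ℕ∞) : ℝ≥0∞) • Measure.dirac (w : ℂ)

/-!
Write `N` for the adjacency matrix of the inclusion graph of a complex `G` of dimension at most one
(rows and columns indexed by the simplices) and `S` for the diagonal matrix which is `1` at vertices
and `-1` at edges. Incident simplices have different dimension, so `S N = -N S`, and the connection
Laplacian is `L = N + S + (1 - S) N² / 2` (`DimLeOne.connectionLaplacian_eq`). This gives the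
hydrogen identity `L² = 1 + N² L` (`connectionForm_sq`): the eigenvalues of `L` are solutions of
`x² = 1 + y x` for eigenvalues `y` of `N²`. Hence the powers of `L` are given by Fibonacci
polynomials in `N²`, the trace of `L ^ k` is, up to a multiple of the Euler characteristic
`χ = tr S`, the trace of a polynomial in `N²` (`trace_connectionForm_pow`), and `L⁻¹ = L - N²`
bounds the spectrum of `L²` away from zero.

The moments of `N²` are controlled by a renormalization. For the refinement `G'` of `G`, the matrix
`N'²` restricted to the vertices of `G'` is `D + N`, where `D` is the degree matrix of the inclusion
graph of `G`; and the two halves of `N'²` have the same non-zero spectrum. So `tr p(N'²)` is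
`2 tr p(D + N)` up to a constant (`DimLeOne.trace_aeval_incl_sq_refine`). All degrees are `2`,
except at a number of simplices which does not grow, so `D` may be replaced by `2` at bounded cost. Thus
`tr (N'² - 2) ^ k` is `2 tr N ^ k` up to a bounded error. For odd `k` this trace is zero; for
`k = 2 j` it is a moment of `N²` of half the degree. Since `4 sin² (π x)` has the same symmetry
under `y ↦ (y - 2)²` (`momentIntegral_odd`, `momentIntegral_even`), induction on the degree identifies the
limits of all moments (`DimLeOne.tendsto_trace_aeval_incl_sq`). By Weierstrass approximation, the
eigenvalues of `L²` equidistribute (`DimLeOne.tendsto_eigMean`), and equicontinuity in `s` makes the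
convergence of the zeta functions uniform on compact sets.

The statements on roots follow from Hurwitz's theorem
(`eventually_zeroLocusMeasure_ball_eq`), a consequence of the argument principle
(`exists_zeroLocusMeasure_ball_eq`): a small disc around a root of the limit finally carries
exactly the multiplicity of that root, and the rest of a compact set carries no root.
-/

/-! ### Zero-locus measures and Hurwitz's theorem -/

theorem analyticOrderAt_ne_top_of_entire {f : ℂ → ℂ} (hf : Differentiable ℂ f) (h0 : f ≠ 0)
    (w : ℂ) : analyticOrderAt f w ≠ ⊤ := by
  rw [Ne, AnalyticOnNhd.analyticOrderAt_eq_top_iff_eq_zero w fun z => hf.analyticAt z]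
  exact h0

theorem exists_entire_eq_pow_mul {w : ℂ} (m : ℕ) : ∀ {f : ℂ → ℂ}, Differentiable ℂ f →
    analyticOrderAt f w = m →
    ∃ g : ℂ → ℂ, Differentiable ℂ g ∧ (∀ z, f z = (z - w) ^ m * g z) ∧ g w ≠ 0 := by
  induction m with
  | zero =>
    intro f hf h
    refine ⟨f, hf, by simp, ?_⟩
    rw [Nat.cast_zero, (hf.analyticAt w).analyticOrderAt_eq_zero] at h
    exact h
  | succ m ih =>
    intro f hf h
    have hw : f w = 0 := by
      apply apply_eq_zero_of_analyticOrderAt_ne_zero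
      rw [h]; simp
    have hg : Differentiable ℂ (dslope f w) := by
      rw [← differentiableOn_univ] at hf ⊢
      exact (Complex.differentiableOn_dslope univ_mem).2 hf
    have hfg : f = (fun z => z - w) * dslope f w := by
      ext z
      have := sub_smul_dslope f w z
      simp only [hw, sub_zero, smul_eq_mul] at this
      simp [this]
    have hid : AnalyticAt ℂ (fun z : ℂ => z - w) w := by fun_prop
    have hord : analyticOrderAt (dslope f w) w = m := by
      rw [hfg, analyticOrderAt_mul hid (hg.analyticAt w)] at h
      have h1 : analyticOrderAt (fun z : ℂ => z - w) w = 1 := analyticOrderAt_id_sub_const_self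
      rw [h1, Nat.cast_add, Nat.cast_one, add_comm] at h
      exact (ENat.add_left_injective_of_ne_top (by simp)) h
    obtain ⟨g, hgd, hgm, hgw⟩ := ih hg hord
    refine ⟨g, hgd, fun z => ?_, hgw⟩
    have := congrFun hfg z
    simp only [Pi.mul_apply] at this
    rw [this, hgm z]
    ring

/-- Finitely many roots of an entire function can be divided out. -/
theorem exists_entire_eq_prod_mul {f : ℂ → ℂ} (hf : Differentiable ℂ f) (h0 : f ≠ 0)
    (Z : Finset ℂ) :
    ∃ g : ℂ → ℂ, Differentiable ℂ g ∧
      (∀ z, f z = (∏ w ∈ Z, (z - w) ^ analyticOrderNatAt f w) * g z) ∧ ∀ w ∈ Z, g w ≠ 0 := by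
  classical
  induction Z using Finset.induction_on with
  | empty => exact ⟨f, hf, by simp, by simp⟩
  | insert a Z ha ih =>
    obtain ⟨g, hg, hfg, hgZ⟩ := ih
    have hP : AnalyticAt ℂ (fun z => ∏ w ∈ Z, (z - w) ^ analyticOrderNatAt f w) a := by
      fun_prop
    have hPa : (∏ w ∈ Z, (a - w) ^ analyticOrderNatAt f w) ≠ 0 :=
      Finset.prod_ne_zero_iff.2 fun w hw => pow_ne_zero _ (sub_ne_zero.2 fun h => ha (h ▸ hw))
    have hord : analyticOrderAt g a = analyticOrderNatAt f a := by
      have h1 : f = (fun z => ∏ w ∈ Z, (z - w) ^ analyticOrderNatAt f w) * g := funext hfg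
      have h2 : analyticOrderAt f a = analyticOrderAt g a := by
        conv_lhs => rw [h1]
        rw [analyticOrderAt_mul hP (hg.analyticAt a), hP.analyticOrderAt_eq_zero.2 hPa, zero_add]
      rw [← h2, Nat.cast_analyticOrderNatAt (analyticOrderAt_ne_top_of_entire hf h0 a)]
    obtain ⟨h, hh, hgh, hha⟩ := exists_entire_eq_pow_mul _ hg hord
    refine ⟨h, hh, fun z => ?_, fun w hw => ?_⟩
    · rw [Finset.prod_insert ha, hfg z, hgh z]; ring
    · rcases Finset.mem_insert.1 hw with rfl | hw
      · exact hha
      · intro h'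
        apply hgZ w hw
        rw [hgh w, h', mul_zero]

theorem finite_zeros_inter_of_isCompact {f : ℂ → ℂ} (hf : Differentiable ℂ f) (h0 : f ≠ 0)
    {K : Set ℂ} (hK : IsCompact K) : (K ∩ {w | f w = 0}).Finite := by
  by_contra hinf
  obtain ⟨z, -, hz⟩ := Set.Infinite.exists_accPt_of_subset_isCompact hinf hK
    Set.inter_subset_left
  have hfr : ∃ᶠ w in 𝓝[≠] z, f w = 0 := by
    rw [accPt_iff_frequently_nhdsNE] at hz
    exact hz.mono fun w hw => hw.2
  apply analyticOrderAt_ne_top_of_entire hf h0 z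
  rw [analyticOrderAt_eq_top]
  exact (hf.analyticAt z).frequently_zero_iff_eventually_zero.1 hfr

theorem zeroLocusMeasure_apply (f : ℂ → ℂ) {A : Set ℂ} (hA : MeasurableSet A) :
    zeroLocusMeasure f A =
      ∑' w : ℂ, A.indicator (fun w => ((analyticOrderAt f w : ℕ∞) : ℝ≥0∞)) w := by
  rw [zeroLocusMeasure, Measure.sum_apply _ hA]
  rw [← tsum_subtype_eq_of_support_subset (s := {w | f w = 0})]
  · refine tsum_congr fun w => ?_
    by_cases hw : (w : ℂ) ∈ A <;> simp [Measure.dirac_apply' _ hA, hw]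
  · intro w hw
    rw [Function.mem_support] at hw
    by_contra hfw
    apply hw
    have : analyticOrderAt f w = 0 := analyticOrderAt_eq_zero.2 (Or.inr hfw)
    simp [this]

theorem zeroLocusMeasure_apply_eq_zero {f : ℂ → ℂ} {A : Set ℂ} (hA : MeasurableSet A)
    (h : ∀ w ∈ A, f w ≠ 0) : zeroLocusMeasure f A = 0 := by
  rw [zeroLocusMeasure_apply f hA, ENNReal.tsum_eq_zero]
  intro w
  by_cases hw : w ∈ A
  · simp [hw, analyticOrderAt_eq_zero.2 (Or.inr (h w hw))]
  · simp [hw]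

theorem zeroLocusMeasure_apply_eq_sum {f : ℂ → ℂ} (hf : Differentiable ℂ f) (h0 : f ≠ 0)
    {A : Set ℂ} (hA : MeasurableSet A) {Z : Finset ℂ} (hZ : ∀ w, w ∈ Z ↔ w ∈ A ∧ f w = 0) :
    zeroLocusMeasure f A = ((∑ w ∈ Z, analyticOrderNatAt f w : ℕ) : ℝ≥0∞) := by
  rw [zeroLocusMeasure_apply f hA, tsum_eq_sum (s := Z), Nat.cast_sum]
  · refine Finset.sum_congr rfl fun w hw => ?_
    rw [Set.indicator_of_mem ((hZ w).1 hw).1, ← Nat.cast_analyticOrderNatAt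
      (analyticOrderAt_ne_top_of_entire hf h0 w), ENat.toENNReal_coe]
  · intro w hw
    by_cases hwA : w ∈ A
    · have : f w ≠ 0 := fun h => hw ((hZ w).2 ⟨hwA, h⟩)
      simp [hwA, analyticOrderAt_eq_zero.2 (Or.inr this)]
    · simp [hwA]

theorem zeroLocusMeasure_lt_top {f : ℂ → ℂ} (hf : Differentiable ℂ f) (h0 : f ≠ 0)
    {K : Set ℂ} (hK : IsCompact K) : zeroLocusMeasure f K < ⊤ := by
  have hfin := finite_zeros_inter_of_isCompact hf h0 hK
  rw [zeroLocusMeasure_apply_eq_sum hf h0 hK.measurableSet (Z := hfin.toFinset) (by simp)]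
  exact ENNReal.natCast_lt_top _

theorem zeroLocusMeasure_const_mul {f : ℂ → ℂ} (hf : Differentiable ℂ f) {c : ℂ} (hc : c ≠ 0) :
    zeroLocusMeasure (fun s => c * f s) = zeroLocusMeasure f := by
  have hord : ∀ w, analyticOrderAt (fun s => c * f s) w = analyticOrderAt f w := fun w => by
    have h1 : AnalyticAt ℂ (fun _ : ℂ => c) w := analyticAt_const
    have := analyticOrderAt_mul h1 (hf.analyticAt w)
    rw [h1.analyticOrderAt_eq_zero.2 hc, zero_add] at this
    exact this
  ext A hA
  rw [zeroLocusMeasure_apply _ hA, zeroLocusMeasure_apply _ hA]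
  simp only [hord]

/-- The argument principle on a disc: after the roots in the disc have been divided out, the
logarithmic derivative is a sum of simple poles and a holomorphic function. -/
theorem exists_zeroLocusMeasure_ball_eq {f : ℂ → ℂ} (hf : Differentiable ℂ f) {c : ℂ} {r : ℝ}
    (hr : 0 < r) (hs : ∀ z ∈ Metric.sphere c r, f z ≠ 0) :
    ∃ N : ℕ, zeroLocusMeasure f (Metric.ball c r) = N ∧
      ∮ z in C(c, r), deriv f z / f z = N * (2 * Real.pi * Complex.I) := by
  have h0 : f ≠ 0 := by
    obtain ⟨z, hz⟩ : (Metric.sphere c r).Nonempty := NormedSpace.sphere_nonempty.2 hr.le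
    exact fun h => hs z hz (by simp [h])
  have hfin := finite_zeros_inter_of_isCompact hf h0 (isCompact_closedBall c r)
  set Z := hfin.toFinset with hZdef
  have hZ : ∀ w, w ∈ Z ↔ w ∈ Metric.ball c r ∧ f w = 0 := by
    intro w
    simp only [hZdef, Set.Finite.mem_toFinset, Set.mem_inter_iff, Set.mem_ofPred_eq]
    refine ⟨fun ⟨h1, h2⟩ => ⟨?_, h2⟩, fun ⟨h1, h2⟩ => ⟨Metric.ball_subset_closedBall h1, h2⟩⟩
    rcases (Metric.mem_closedBall.1 h1).lt_or_eq with h | h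
    · exact h
    · exact absurd h2 (hs w h)
  refine ⟨∑ w ∈ Z, analyticOrderNatAt f w,
    zeroLocusMeasure_apply_eq_sum hf h0 measurableSet_ball hZ, ?_⟩
  obtain ⟨g, hg, hfg, hgZ⟩ := exists_entire_eq_prod_mul hf h0 Z
  have hgne : ∀ z ∈ Metric.closedBall c r, g z ≠ 0 := by
    intro z hz hgz
    have hfz : f z = 0 := by rw [hfg z, hgz, mul_zero]
    exact hgZ z (by simp [hZdef, hfz, Metric.mem_closedBall.1 hz]) hgz
  have hsub : ∀ z ∈ Metric.sphere c r, ∀ w ∈ Z, z - w ≠ 0 := by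
    intro z hz w hw h
    rw [sub_eq_zero.1 h] at hz
    exact hs w hz ((hZ w).1 hw).2
  have hlog : ∀ z ∈ Metric.sphere c r, deriv f z / f z =
      (∑ w ∈ Z, (analyticOrderNatAt f w : ℂ) * (z - w)⁻¹) + deriv g z / g z := by
    intro z hz
    have hfe : f = fun z => (∏ w ∈ Z, (z - w) ^ analyticOrderNatAt f w) * g z := funext hfg
    have hPz : (∏ w ∈ Z, (z - w) ^ analyticOrderNatAt f w) ≠ 0 :=
      Finset.prod_ne_zero_iff.2 fun w hw => pow_ne_zero _ (hsub z hz w hw)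
    change logDeriv f z = _ + logDeriv g z
    conv_lhs => rw [hfe]
    rw [logDeriv_mul (f := fun z => ∏ w ∈ Z, (z - w) ^ analyticOrderNatAt f w) (g := g) z hPz
      (hgne z (Metric.sphere_subset_closedBall hz)) (by fun_prop) (hg z)]
    congr 1
    rw [logDeriv_prod (f := fun w z => (z - w) ^ analyticOrderNatAt f w)
      (fun w hw => pow_ne_zero _ (hsub z hz w hw)) (fun w _ => by fun_prop)]
    refine Finset.sum_congr rfl fun w hw => ?_
    rw [logDeriv_fun_pow (by fun_prop)]
    simp [logDeriv_apply]
  rw [circleIntegral.integral_congr hr.le hlog]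
  have hcont : ContinuousOn (fun z => deriv g z / g z) (Metric.closedBall c r) :=
    (hg.contDiff.continuous_deriv le_top).continuousOn.div hg.continuous.continuousOn hgne
  have hI : ∀ w ∈ Z, CircleIntegrable (fun z => (analyticOrderNatAt f w : ℂ) * (z - w)⁻¹) c r := by
    intro w hw
    apply ContinuousOn.circleIntegrable hr.le
    exact continuousOn_const.mul ((by fun_prop : Continuous fun z : ℂ => z - w).continuousOn.inv₀
      fun z hz => hsub z hz w hw)
  rw [circleIntegral.integral_add (CircleIntegrable.fun_sum Z hI)
    ((hcont.mono Metric.sphere_subset_closedBall).circleIntegrable hr.le)]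
  rw [circleIntegral.integral_fun_sum hI]
  rw [Complex.circleIntegral_eq_zero_of_differentiable_on_off_countable hr.le Set.countable_empty
    hcont, add_zero, Nat.cast_sum, Finset.sum_mul]
  · refine Finset.sum_congr rfl fun w hw => ?_
    rw [circleIntegral.integral_const_mul, circleIntegral.integral_sub_inv_of_mem_ball
      ((hZ w).1 hw).1]
  · intro z hz
    have h1 : DifferentiableAt ℂ (deriv g) z := (hg.analyticAt z).deriv.differentiableAt
    exact h1.div (hg z) (hgne z (Metric.ball_subset_closedBall hz.1))

theorem eventually_forall_ne_zero_of_isCompact {F : ℕ → ℂ → ℂ} {f : ℂ → ℂ} (hf : Continuous f)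
    {K : Set ℂ} (hK : IsCompact K) (h : TendstoUniformlyOn F f atTop K)
    (hs : ∀ z ∈ K, f z ≠ 0) : ∀ᶠ n in atTop, ∀ z ∈ K, F n z ≠ 0 := by
  obtain rfl | hne := K.eq_empty_or_nonempty
  · simp
  obtain ⟨z₀, hz₀, hmin⟩ := hK.exists_isMinOn hne hf.norm.continuousOn
  have hpos : 0 < ‖f z₀‖ := norm_pos_iff.2 (hs z₀ hz₀)
  filter_upwards [Metric.tendstoUniformlyOn_iff.1 h _ hpos] with n hn z hz h0
  have h1 := hn z hz
  rw [h0, dist_zero_right] at h1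
  exact absurd (hmin hz) (not_le.2 h1)

/-- Hurwitz's theorem: the circle integrals which count the roots converge, and they are
integer multiples of `2πi`. -/
theorem eventually_zeroLocusMeasure_ball_eq {F : ℕ → ℂ → ℂ} {f : ℂ → ℂ}
    (hF : ∀ n, Differentiable ℂ (F n)) (hf : Differentiable ℂ f)
    (h : TendstoLocallyUniformlyOn F f atTop Set.univ) {c : ℂ} {r : ℝ}
    (hr : 0 < r) (hs : ∀ z ∈ Metric.sphere c r, f z ≠ 0) :
    ∀ᶠ n in atTop, zeroLocusMeasure (F n) (Metric.ball c r) =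
      zeroLocusMeasure f (Metric.ball c r) := by
  have hsph : IsCompact (Metric.sphere c r) := isCompact_sphere c r
  have hd := (h.deriv (.of_forall fun n => (hF n).differentiableOn) isOpen_univ).mono
    (Set.subset_univ (Metric.sphere c r))
  have hcd : ∀ {g : ℂ → ℂ}, Differentiable ℂ g → Continuous (deriv g) := fun hg =>
    hg.contDiff.continuous_deriv le_top
  have hunif : TendstoUniformlyOn F f atTop (Metric.sphere c r) :=
    (tendstoLocallyUniformlyOn_iff_tendstoUniformlyOn_of_compact hsph).1
      (h.mono (Set.subset_univ _))
  have hne := eventually_forall_ne_zero_of_isCompact hf.continuous hsph hunif hs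
  have hq := hd.div₀ (h.mono (Set.subset_univ _)) (hcd hf).continuousOn
    hf.continuous.continuousOn hs
  rw [tendstoLocallyUniformlyOn_iff_tendstoUniformlyOn_of_compact hsph] at hq
  have hint := hq.tendsto_circleIntegral_of_continuousOn hr.le (by
    filter_upwards [hne] with n hn
    exact (hcd (hF n)).continuousOn.div (hF n).continuous.continuousOn hn)
  obtain ⟨N, hN, hIN⟩ := exists_zeroLocusMeasure_ball_eq hf hr hs
  have hpi : (2 * Real.pi * Complex.I : ℂ) ≠ 0 := Complex.two_pi_I_ne_zero
  have hlim : Tendsto (fun n => (∮ z in C(c, r), (deriv ∘ F / F) n z) / (2 * Real.pi * Complex.I))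
      atTop (𝓝 (N : ℂ)) := by
    have h1 := hint.div_const (2 * Real.pi * Complex.I : ℂ)
    have h2 : (∮ z in C(c, r), (deriv f / f) z) = N * (2 * Real.pi * Complex.I) := hIN
    rwa [h2, mul_div_cancel_right₀ _ hpi] at h1
  filter_upwards [hne, Metric.tendsto_nhds.1 hlim 1 one_pos] with n hn hdist
  obtain ⟨M, hM, hIM⟩ := exists_zeroLocusMeasure_ball_eq (hF n) hr hn
  have h2 : (∮ z in C(c, r), (deriv ∘ F / F) n z) = M * (2 * Real.pi * Complex.I) := hIM
  rw [h2, mul_div_cancel_right₀ _ hpi, Complex.dist_eq] at hdist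
  -- Two natural numbers at distance less than one are equal.
  have h3 : ‖((M - N : ℤ) : ℂ)‖ < 1 := by simpa using hdist
  rw [Complex.norm_intCast] at h3
  have h4 : |(M - N : ℤ)| < 1 := by exact_mod_cast h3
  have h5 : M = N := by
    have := Int.abs_lt_one_iff.1 h4
    omega
  rw [hM, hN, h5]

/-- If all roots of `f` in `K` are interior points of `K`, then the zero-locus measures converge
weakly on `K`: small discs around the roots of `f` carry, by Hurwitz's theorem, the right mass, and
the rest of `K` carries no mass at all. -/
theorem tendsto_setIntegral_zeroLocusMeasure {F : ℕ → ℂ → ℂ} {f : ℂ → ℂ}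
    (hF : ∀ n, Differentiable ℂ (F n)) (hF0 : ∀ n, F n ≠ 0) (hf : Differentiable ℂ f)
    (hf0 : f ≠ 0) (h : TendstoLocallyUniformlyOn F f atTop Set.univ) {K : Set ℂ}
    (hK : IsCompact K) (hfr : ∀ w ∈ frontier K, f w ≠ 0) {φ : ℂ → ℝ} (hφ : Continuous φ) :
    Tendsto (fun n => ∫ w in K, φ w ∂(zeroLocusMeasure (F n))) atTop
      (𝓝 (∫ w in K, φ w ∂(zeroLocusMeasure f))) := by
  have hfin := finite_zeros_inter_of_isCompact hf hf0 hK
  set Z := hfin.toFinset with hZdef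
  have hZ : ∀ w, w ∈ Z ↔ w ∈ K ∧ f w = 0 := by simp [hZdef]
  rw [Metric.tendsto_nhds]
  intro ε hε
  set m : ℝ := ∑ w ∈ Z, (analyticOrderNatAt f w : ℝ) with hm
  have hm0 : 0 ≤ m := Finset.sum_nonneg fun _ _ => Nat.cast_nonneg _
  set η : ℝ := ε / (2 * m + 1) with hη
  have hη0 : 0 < η := by positivity
  have hr : ∀ w ∈ Z, ∀ᶠ r in 𝓝[>] (0 : ℝ), Metric.closedBall w r ⊆ K ∧
      (∀ z ∈ Metric.closedBall w r, |φ z - φ w| ≤ η) ∧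
      (∀ z ∈ Z, z ≠ w → r < dist z w / 2) := by
    intro w hw
    have hint : w ∈ interior K := by
      by_contra hni
      exact hfr w ⟨subset_closure ((hZ w).1 hw).1, hni⟩ ((hZ w).1 hw).2
    have h1 : ∀ᶠ z in 𝓝 w, z ∈ K ∧ |φ z - φ w| ≤ η := by
      refine Filter.Eventually.and (mem_interior_iff_mem_nhds.1 hint) ?_
      filter_upwards [Metric.tendsto_nhds.1 (hφ.tendsto w) η hη0] with z hz
      exact (Real.dist_eq _ _ ▸ hz).le
    obtain ⟨δ, hδ, hball⟩ := Metric.eventually_nhds_iff_ball.1 h1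
    have h2 : ∀ᶠ r in 𝓝[>] (0 : ℝ), ∀ z ∈ Z, z ≠ w → r < dist z w / 2 := by
      rw [Filter.eventually_all_finset]
      intro z _
      by_cases hzw : z = w
      · simp [hzw]
      · have : 0 < dist z w / 2 := half_pos (dist_pos.2 hzw)
        filter_upwards [nhdsWithin_le_nhds (Iio_mem_nhds this)] with r hr _ using hr
    filter_upwards [h2, nhdsWithin_le_nhds (Iio_mem_nhds hδ)] with r hr2 hrδ
    have hsub : Metric.closedBall w r ⊆ Metric.ball w δ := Metric.closedBall_subset_ball hrδ
    exact ⟨fun z hz => (hball z (hsub hz)).1, fun z hz => (hball z (hsub hz)).2, hr2⟩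
  -- One radius that works for all roots of `f` in `K`; the discs are then disjoint.
  obtain ⟨r, hrall, hr0⟩ := (((Filter.eventually_all_finset Z).2 hr).and
    self_mem_nhdsWithin).exists
  have hr0 : 0 < r := hr0
  have hdisj : (Z : Set ℂ).Pairwise (Function.onFun Disjoint fun w => Metric.ball w r) := by
    intro z hz w hw hzw
    apply Metric.ball_disjoint_ball
    linarith [(hrall w hw).2.2 z hz hzw]
  set K' : Set ℂ := K \ ⋃ w ∈ Z, Metric.ball w r with hK'
  have hopen : IsOpen (⋃ w ∈ Z, Metric.ball w r) :=
    isOpen_biUnion fun _ _ => Metric.isOpen_ball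
  have hK'c : IsCompact K' := hK.diff hopen
  have hK'0 : ∀ z ∈ K', f z ≠ 0 := fun z hz hfz =>
    hz.2 (Set.mem_biUnion ((hZ z).2 ⟨hz.1, hfz⟩) (Metric.mem_ball_self hr0))
  have hunif : TendstoUniformlyOn F f atTop K' :=
    (tendstoLocallyUniformlyOn_iff_tendstoUniformlyOn_of_compact hK'c).1
      (h.mono (Set.subset_univ _))
  have hballZ : ∀ w ∈ Z, zeroLocusMeasure f (Metric.ball w r) = (analyticOrderNatAt f w : ℕ) := by
    intro w hw
    rw [zeroLocusMeasure_apply_eq_sum hf hf0 measurableSet_ball (Z := {w}), Finset.sum_singleton]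
    intro z
    rw [Finset.mem_singleton]
    refine ⟨?_, fun ⟨hz1, hz2⟩ => ?_⟩
    · rintro rfl
      exact ⟨Metric.mem_ball_self hr0, ((hZ z).1 hw).2⟩
    · by_contra hzw
      have hz : z ∈ Z := (hZ z).2 ⟨(hrall w hw).1 (Metric.ball_subset_closedBall hz1), hz2⟩
      have h3 := (hrall w hw).2.2 z hz hzw
      have h4 := Metric.mem_ball.1 hz1
      linarith
  -- Any zero-locus measure with the right masses has an integral close to the expected sum.
  have key : ∀ g : ℂ → ℂ, Differentiable ℂ g → g ≠ 0 → (∀ z ∈ K', g z ≠ 0) →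
      (∀ w ∈ Z, zeroLocusMeasure g (Metric.ball w r) = (analyticOrderNatAt f w : ℕ)) →
      |(∫ z in K, φ z ∂(zeroLocusMeasure g)) - ∑ w ∈ Z, (analyticOrderNatAt f w : ℝ) * φ w|
        ≤ η * m := by
    intro g hg hg0 hgK hgball
    have hIK : IntegrableOn φ K (zeroLocusMeasure g) :=
      hφ.continuousOn.integrableOn_of_subset_isCompact hK hK.measurableSet subset_rfl
        (zeroLocusMeasure_lt_top hg hg0 hK).ne
    have hU : (⋃ w ∈ Z, Metric.ball w r) ⊆ K := Set.iUnion₂_subset fun w hw =>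
      Metric.ball_subset_closedBall.trans (hrall w hw).1
    have h1 : (∫ z in K, φ z ∂(zeroLocusMeasure g)) =
        ∑ w ∈ Z, ∫ z in Metric.ball w r, φ z ∂(zeroLocusMeasure g) := by
      rw [← integral_biUnion_finset Z (fun _ _ => measurableSet_ball) hdisj fun w hw =>
        hIK.mono_set (Metric.ball_subset_closedBall.trans (hrall w hw).1)]
      refine (setIntegral_eq_of_subset_of_ae_sdiff_eq_zero hK.measurableSet.nullMeasurableSet
        hU ?_)
      rw [ae_iff]
      refine measure_mono_null (fun z hz => ?_)
        (zeroLocusMeasure_apply_eq_zero hK'c.measurableSet hgK)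
      by_contra hz'
      exact hz fun hz2 => absurd hz2 hz'
    rw [h1, ← Finset.sum_sub_distrib, hm, Finset.mul_sum]
    refine (Finset.abs_sum_le_sum_abs _ _).trans (Finset.sum_le_sum fun w hw => ?_)
    have hreal : (zeroLocusMeasure g).real (Metric.ball w r) = analyticOrderNatAt f w := by
      rw [measureReal_def, hgball w hw, ENNReal.toReal_natCast]
    have hlt : zeroLocusMeasure g (Metric.ball w r) < ⊤ := by
      rw [hgball w hw]; exact ENNReal.natCast_lt_top _
    have h2 : (analyticOrderNatAt f w : ℝ) * φ w =
        ∫ _ in Metric.ball w r, φ w ∂(zeroLocusMeasure g) := by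
      rw [setIntegral_const, hreal, smul_eq_mul]
    rw [h2, ← integral_sub (hIK.mono_set (Metric.ball_subset_closedBall.trans (hrall w hw).1))
      (integrableOn_const hlt.ne), ← Real.norm_eq_abs, ← hreal]
    exact norm_setIntegral_le_of_norm_le_const hlt fun z hz =>
      (hrall w hw).2.1 z (Metric.ball_subset_closedBall hz)
  have hsphere : ∀ w ∈ Z, ∀ z ∈ Metric.sphere w r, f z ≠ 0 := by
    intro w hw z hz hfz
    have hzZ : z ∈ Z := (hZ z).2 ⟨(hrall w hw).1 (Metric.sphere_subset_closedBall hz), hfz⟩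
    have hzw : z ≠ w := by
      rintro rfl
      simp [hr0.ne] at hz
    have h3 := (hrall w hw).2.2 z hzZ hzw
    rw [Metric.mem_sphere.1 hz] at h3
    linarith
  have hev : ∀ᶠ n in atTop, ∀ w ∈ Z,
      zeroLocusMeasure (F n) (Metric.ball w r) = zeroLocusMeasure f (Metric.ball w r) :=
    (Filter.eventually_all_finset Z).2 fun w hw =>
      eventually_zeroLocusMeasure_ball_eq hF hf h hr0 (hsphere w hw)
  filter_upwards [hev, eventually_forall_ne_zero_of_isCompact hf.continuous hK'c hunif hK'0]
    with n hn1 hn2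
  have h1 := key (F n) (hF n) (hF0 n) hn2 fun w hw => (hn1 w hw).trans (hballZ w hw)
  have h2 := key f hf hf0 hK'0 hballZ
  have h3 : η * m + η * m < ε := by
    have : η * (2 * m + 1) = ε := by rw [hη]; field_simp
    linarith
  rw [Real.dist_eq]
  rw [abs_le] at h1 h2
  rw [abs_lt]
  constructor <;> linarith [h1.1, h1.2, h2.1, h2.2]

theorem tendsto_integral_zeroLocusMeasure {F : ℕ → ℂ → ℂ} {f : ℂ → ℂ}
    (hF : ∀ n, Differentiable ℂ (F n)) (hF0 : ∀ n, F n ≠ 0) (hf : Differentiable ℂ f)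
    (hf0 : f ≠ 0) (h : TendstoLocallyUniformlyOn F f atTop Set.univ) {φ : ℂ → ℝ}
    (hφ : Continuous φ) (hs : HasCompactSupport φ) :
    Tendsto (fun n => ∫ w, φ w ∂(zeroLocusMeasure (F n))) atTop
      (𝓝 (∫ w, φ w ∂(zeroLocusMeasure f))) := by
  obtain ⟨R, hR⟩ := hs.isCompact.isBounded.subset_closedBall 0
  -- A disc that contains the support and carries no root of `f` on its boundary.
  have hfin := (finite_zeros_inter_of_isCompact hf hf0
    (isCompact_closedBall (0 : ℂ) (R + 1))).image norm
  obtain ⟨r, hr, hrn⟩ := ((Set.Ioo_infinite (lt_add_one R)).sdiff hfin).nonempty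
  have hfr : ∀ w ∈ frontier (Metric.closedBall (0 : ℂ) r), f w ≠ 0 := by
    intro w hw hfw
    have hw' : ‖w‖ = r := by simpa using Metric.frontier_closedBall_subset_sphere hw
    refine hrn ⟨w, ⟨?_, hfw⟩, hw'⟩
    rw [mem_closedBall_zero_iff, hw']
    exact hr.2.le
  have hmain := tendsto_setIntegral_zeroLocusMeasure hF hF0 hf hf0 h
    (isCompact_closedBall (0 : ℂ) r) hfr hφ
  have heq : ∀ μ : Measure ℂ, ∫ w in Metric.closedBall (0 : ℂ) r, φ w ∂μ = ∫ w, φ w ∂μ := by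
    intro μ
    refine setIntegral_eq_integral_of_forall_compl_eq_zero fun w hw => ?_
    by_contra hne
    exact hw (Metric.closedBall_subset_closedBall hr.1.le (hR (subset_tsupport φ hne)))
  simpa only [heq] using hmain

/-! ### Matrices with an anticommuting involution -/

section MatrixAlgebra
open Matrix Polynomial
open scoped Matrix.Norms.Operator

variable {ι : Type*} [Fintype ι] [DecidableEq ι]

theorem Matrix.trace_eq_zero_of_anticommute {S X : Matrix ι ι ℝ} (hS : S * S = 1)
    (hX : S * X = -(X * S)) : X.trace = 0 := by
  have h1 : (S * X * S).trace = X.trace := by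
    rw [Matrix.trace_mul_cycle, hS, one_mul]
  have h2 : (S * X * S).trace = -X.trace := by
    rw [hX, neg_mul, Matrix.trace_neg, mul_assoc, hS, mul_one]
  linarith

theorem Matrix.commute_sq_of_anticommute {S N : Matrix ι ι ℝ} (hSN : S * N = -(N * S)) :
    Commute S (N ^ 2) := by
  rw [Commute, SemiconjBy, pow_two, ← mul_assoc, hSN, neg_mul, mul_assoc, hSN, mul_neg, neg_neg,
    mul_assoc]

theorem Polynomial.commute_aeval {A : Type*} [Ring A] [Algebra ℝ A] {a b : A} (h : Commute a b)
    (p : ℝ[X]) : Commute a (aeval b p) := by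
  induction p using Polynomial.induction_on' with
  | add p q hp hq => rw [map_add]; exact hp.add_right hq
  | monomial n r =>
    rw [aeval_monomial]
    exact (Algebra.commute_algebraMap_right r a).mul_right (h.pow_right n)

/-- Odd functions of `N` have trace zero. -/
theorem Matrix.trace_mul_aeval_sq_eq_zero {S N : Matrix ι ι ℝ} (hS : S * S = 1)
    (hSN : S * N = -(N * S)) (p : ℝ[X]) : (N * aeval (N ^ 2) p).trace = 0 := by
  refine Matrix.trace_eq_zero_of_anticommute hS ?_
  rw [← mul_assoc, hSN, neg_mul, mul_assoc, mul_assoc,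
    (commute_aeval (Matrix.commute_sq_of_anticommute hSN) p).eq]

/-- The supertrace of `p(N²)` is that of its constant term: conjugation by `S` and cyclicity of the
trace give opposite signs for the supertrace of a positive power of `N²`. -/
theorem Matrix.trace_involution_mul_aeval_sq {S N : Matrix ι ι ℝ}
    (hSN : S * N = -(N * S)) (p : ℝ[X]) :
    (S * aeval (N ^ 2) p).trace = p.coeff 0 * S.trace := by
  have hN : Commute N (N ^ 2) := (Commute.refl N).pow_right 2
  have h0 : ∀ q : ℝ[X], (S * (N ^ 2 * aeval (N ^ 2) q)).trace = 0 := by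
    intro q
    have h1 : (S * (N ^ 2 * aeval (N ^ 2) q)).trace = -(S * (N ^ 2 * aeval (N ^ 2) q)).trace := by
      calc (S * (N ^ 2 * aeval (N ^ 2) q)).trace = -(N * (S * (N * aeval (N ^ 2) q))).trace := by
            rw [pow_two, mul_assoc, ← mul_assoc S N, hSN, neg_mul, trace_neg, mul_assoc]
        _ = -(S * (N * aeval (N ^ 2) q) * N).trace := by rw [trace_mul_comm]
        _ = -(S * (N ^ 2 * aeval (N ^ 2) q)).trace := by
            rw [mul_assoc, mul_assoc N, ← (commute_aeval hN q).eq, ← mul_assoc N, ← pow_two]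
    linarith
  conv_lhs => rw [← divX_mul_X_add p]
  rw [map_add, map_mul, aeval_X, aeval_C, (commute_aeval (Commute.refl (N ^ 2)) p.divX).eq.symm,
    mul_add, trace_add, h0, zero_add, Algebra.algebraMap_eq_smul_one, mul_smul_comm, mul_one,
    trace_smul, smul_eq_mul]

/-- The Fibonacci polynomials `F₀ = 0`, `F₁ = 1`, `F_{k+2} = X F_{k+1} + F_k`. -/
noncomputable def fibPoly : ℕ → ℝ[X]
  | 0 => 0
  | 1 => 1
  | k + 2 => X * fibPoly (k + 1) + fibPoly k

/-- Used both for matrices and, with `A = ℝ`, for the roots of `x² = 1 + yx`. -/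
theorem pow_succ_eq_fibPoly {A : Type*} [Ring A] [Algebra ℝ A] {L H : A}
    (h : L ^ 2 = 1 + H * L) (k : ℕ) :
    L ^ (k + 1) = aeval H (fibPoly (k + 1)) * L + aeval H (fibPoly k) := by
  induction k with
  | zero => simp [fibPoly]
  | succ k ih =>
    rw [pow_succ, ih, fibPoly, map_add, map_mul, aeval_X, add_mul, mul_assoc, ← pow_two, h,
      (commute_aeval (Commute.refl H) (fibPoly (k + 1))).eq]
    noncomm_ring

/-- Half the trace `x₊ᵏ⁺¹ + x₋ᵏ⁺¹` of the roots of `x² = 1 + yx`, as a polynomial in `y`. -/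
noncomputable def meanPowPoly (k : ℕ) : ℝ[X] := C (1 / 2) * (X * fibPoly (k + 1)) + fibPoly k

theorem eval_meanPowPoly {y x₁ x₂ : ℝ} (h₁ : x₁ ^ 2 = 1 + y * x₁) (h₂ : x₂ ^ 2 = 1 + y * x₂)
    (h : x₁ + x₂ = y) (k : ℕ) :
    (meanPowPoly k).eval y = (x₁ ^ (k + 1) + x₂ ^ (k + 1)) / 2 := by
  rw [pow_succ_eq_fibPoly h₁, pow_succ_eq_fibPoly h₂]
  simp only [meanPowPoly, coe_aeval_eq_eval, eval_add, eval_mul, eval_C, eval_X]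
  linear_combination (-(fibPoly (k + 1)).eval y / 2) * h

/-- The connection Laplacian of a complex of dimension at most one in terms of the adjacency
matrix `N` of the inclusion graph and of the sign matrix `S` (`1` at vertices, `-1` at edges). -/
noncomputable def connectionForm (N S : Matrix ι ι ℝ) : Matrix ι ι ℝ :=
  N + S + (1 / 2 : ℝ) • ((1 - S) * N ^ 2)

theorem commute_connectionForm {N S : Matrix ι ι ℝ} (hSN : S * N = -(N * S)) :
    Commute (N ^ 2) (connectionForm N S) := by
  have h1 : Commute (N ^ 2) S := (Matrix.commute_sq_of_anticommute hSN).symm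
  have h2 : Commute (N ^ 2) N := (Commute.refl N).pow_left 2
  exact (h2.add_right h1).add_right
    ((((Commute.one_right _).sub_right h1).mul_right (Commute.refl _)).smul_right _)

/-- The hydrogen identity `L - L⁻¹ = N²`, multiplied by `L`. -/
theorem connectionForm_sq {N S : Matrix ι ι ℝ} (hS : S * S = 1) (hSN : S * N = -(N * S)) :
    connectionForm N S ^ 2 = 1 + N ^ 2 * connectionForm N S := by
  have hc := (Matrix.commute_sq_of_anticommute hSN).eq
  set H := N ^ 2 with hH
  have hNH : N * H = H * N := ((Commute.refl N).pow_right 2).eq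
  have e1 : N * (S * H) = -(S * H * N) := by
    rw [← mul_assoc, ← neg_eq_iff_eq_neg.2 hSN, neg_mul, mul_assoc, hNH, ← mul_assoc]
  have e2 : S * (S * H) = H := by rw [← mul_assoc, hS, one_mul]
  have e3 : S * H * S = H := by rw [hc, mul_assoc, hS, mul_one]
  have e4 : S * H * (S * H) = H * H := by rw [← mul_assoc, e3]
  have e5 : H * (S * H) = S * H * H := by rw [← mul_assoc, ← hc]
  have e6 : H * S = S * H := hc.symm
  have e7 : N * S = -(S * N) := by rw [hSN, neg_neg]
  have e8 : N * N = H := by rw [hH, pow_two]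
  have hform : connectionForm N S = N + S + (1 / 2 : ℝ) • (H - S * H) := by
    rw [connectionForm, sub_mul, one_mul]
  rw [hform, pow_two]
  simp only [mul_add, add_mul, mul_sub, sub_mul, mul_smul_comm, smul_mul_assoc, smul_sub, smul_add,
    e1, e2, e3, e4, e5, e6, e7, e8, hS, hNH]
  module

theorem trace_connectionForm_pow {N S : Matrix ι ι ℝ} (hS : S * S = 1)
    (hSN : S * N = -(N * S)) (k : ℕ) :
    (connectionForm N S ^ (k + 1)).trace =
      (aeval (N ^ 2) (meanPowPoly k)).trace + (fibPoly (k + 1)).coeff 0 * S.trace := by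
  rw [pow_succ_eq_fibPoly (connectionForm_sq hS hSN), trace_add]
  set a := fibPoly (k + 1) with ha
  have h1 := Matrix.trace_mul_aeval_sq_eq_zero hS hSN a
  have h2 := Matrix.trace_involution_mul_aeval_sq hSN a
  have h3 := Matrix.trace_involution_mul_aeval_sq hSN (X * a)
  rw [coeff_X_mul_zero, zero_mul, map_mul, aeval_X] at h3
  have h4 : (aeval (N ^ 2) a * connectionForm N S).trace =
      (N * aeval (N ^ 2) a).trace + (S * aeval (N ^ 2) a).trace +
        (1 / 2) * ((N ^ 2 * aeval (N ^ 2) a).trace - (S * (N ^ 2 * aeval (N ^ 2) a)).trace) := by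
    rw [trace_mul_comm, connectionForm, add_mul, add_mul, trace_add, trace_add, smul_mul_assoc,
      trace_smul, smul_eq_mul, sub_mul, sub_mul, trace_sub, one_mul, mul_assoc]
  rw [h4, h1, h2, h3, meanPowPoly, map_add, map_mul, aeval_C, map_mul, aeval_X, trace_add, ← ha,
    Algebra.algebraMap_eq_smul_one, smul_mul_assoc, one_mul, trace_smul, smul_eq_mul]
  ring

/-- The inverse of `L` is `L - N²`. -/
theorem connectionForm_mul_inverse {N S : Matrix ι ι ℝ} (hS : S * S = 1)
    (hSN : S * N = -(N * S)) :
    (connectionForm N S - N ^ 2) ^ 2 * connectionForm N S ^ 2 = 1 := by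
  have hc := commute_connectionForm hSN
  have h1 : (connectionForm N S - N ^ 2) * connectionForm N S = 1 := by
    rw [sub_mul, ← pow_two, connectionForm_sq hS hSN, add_sub_cancel_right]
  have h2 : Commute (connectionForm N S - N ^ 2) (connectionForm N S) :=
    (Commute.refl _).sub_left hc
  rw [← h2.mul_pow, h1, one_pow]

theorem Matrix.abs_apply_le_norm (A : Matrix ι ι ℝ) (i j : ι) : |A i j| ≤ ‖A‖ := by
  have h := Matrix.linfty_opNorm_mulVec A (Pi.single j 1)
  rw [Matrix.mulVec_single_one, Pi.norm_single, norm_one, mul_one] at h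
  exact (norm_le_pi_norm (A.col j) i).trans h

/-- Two matrices which differ by a diagonal matrix with few non-zero entries have almost the same
moments. The factor `Y` is there for the induction on `k`. -/
theorem Matrix.abs_trace_pow_sub_le {A B : Matrix ι ι ℝ} {d : ι → ℝ} {R : ℝ} (hA : ‖A‖ ≤ R)
    (hB : ‖B‖ ≤ R) (hAB : A - B = diagonal d) (hd : ∀ i, |d i| ≤ R) (k : ℕ) (Y : Matrix ι ι ℝ) :
    |((A ^ k - B ^ k) * Y).trace| ≤
      k * R ^ k * ‖Y‖ * (Finset.univ.filter fun i => d i ≠ 0).card := by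
  have hR : 0 ≤ R := (norm_nonneg A).trans hA
  have hdiag : ∀ Y : Matrix ι ι ℝ, |(diagonal d * Y).trace| ≤
      R * ‖Y‖ * (Finset.univ.filter fun i => d i ≠ 0).card := by
    intro Y
    have h1 : (diagonal d * Y).trace = ∑ i ∈ Finset.univ.filter fun i => d i ≠ 0, d i * Y i i := by
      rw [Matrix.trace, Finset.sum_filter]
      refine Finset.sum_congr rfl fun i _ => ?_
      by_cases h : d i = 0 <;> simp [Matrix.diag, h]
    rw [h1, mul_comm, ← nsmul_eq_mul]
    refine (Finset.abs_sum_le_sum_abs _ _).trans (Finset.sum_le_card_nsmul _ _ _ fun i _ => ?_)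
    rw [abs_mul]
    exact mul_le_mul (hd i) (Matrix.abs_apply_le_norm Y i i) (abs_nonneg _) hR
  induction k generalizing Y with
  | zero => simp
  | succ k ih =>
    have h1 : (A ^ (k + 1) - B ^ (k + 1)) * Y =
        A ^ k * (diagonal d * Y) + (A ^ k - B ^ k) * (B * Y) := by
      rw [← hAB]; noncomm_ring
    have h2 : ‖Y * A ^ k‖ ≤ R ^ k * ‖Y‖ := by
      clear ih h1
      induction k with
      | zero => simp
      | succ k ih =>
        rw [pow_succ, ← mul_assoc, pow_succ]
        refine (norm_mul_le _ _).trans ?_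
        calc ‖Y * A ^ k‖ * ‖A‖ ≤ (R ^ k * ‖Y‖) * R := by gcongr
          _ = _ := by ring
    have h3 : ‖B * Y‖ ≤ R * ‖Y‖ := (norm_mul_le _ _).trans (by gcongr)
    set b : ℝ := ((Finset.univ.filter fun i => d i ≠ 0).card : ℝ) with hb
    have hb0 : 0 ≤ b := Nat.cast_nonneg _
    rw [h1, trace_add, trace_mul_comm, mul_assoc]
    calc |(diagonal d * (Y * A ^ k)).trace + ((A ^ k - B ^ k) * (B * Y)).trace|
        ≤ |(diagonal d * (Y * A ^ k)).trace| + |((A ^ k - B ^ k) * (B * Y)).trace| := abs_add_le _ _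
      _ ≤ R * ‖Y * A ^ k‖ * b + k * R ^ k * ‖B * Y‖ * b := add_le_add (hdiag _) (ih _)
      _ ≤ R * (R ^ k * ‖Y‖) * b + k * R ^ k * (R * ‖Y‖) * b := by gcongr
      _ = _ := by push_cast; ring

theorem Matrix.IsHermitian.trace_aeval {A : Matrix ι ι ℝ} (hA : A.IsHermitian) (p : ℝ[X]) :
    (aeval A p).trace = ∑ i, p.eval (hA.eigenvalues i) := by
  have hD : aeval (diagonal hA.eigenvalues) p = diagonal fun i => p.eval (hA.eigenvalues i) := by
    change aeval (diagonalAlgHom ℝ hA.eigenvalues) p = _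
    rw [aeval_algHom_apply, diagonalAlgHom_apply]
    congr 1
    ext i
    rw [aeval_pi_apply]
    exact congrFun (coe_aeval_eq_eval _) p
  have hA' : A = Unitary.conjStarAlgAut ℝ _ hA.eigenvectorUnitary (diagonal hA.eigenvalues) :=
    hA.spectral_theorem
  set φ := Unitary.conjStarAlgAut ℝ (Matrix ι ι ℝ) hA.eigenvectorUnitary with hφ
  have h1 : aeval A p = φ (aeval (diagonal hA.eigenvalues) p) := by
    conv_lhs => rw [hA']
    exact aeval_algHom_apply φ.toAlgEquiv.toAlgHom _ p
  rw [h1, hD, hφ, Unitary.conjStarAlgAut_apply, Matrix.trace_mul_cycle, Unitary.coe_star_mul_self,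
    one_mul, trace_diagonal]

theorem Matrix.IsHermitian.abs_eigenvalues_le {A : Matrix ι ι ℝ} (hA : A.IsHermitian) (i : ι) :
    |hA.eigenvalues i| ≤ ‖A‖ := by
  set v : ι → ℝ := ⇑(hA.eigenvectorBasis i) with hv
  have hv0 : 0 < ‖v‖ := norm_pos_iff.2
    ((WithLp.ofLp_eq_zero 2).ne.2 <| hA.eigenvectorBasis.orthonormal.ne_zero i)
  have h1 := Matrix.linfty_opNorm_mulVec A v
  rw [hv, hA.mulVec_eigenvectorBasis i, norm_smul, ← hv, Real.norm_eq_abs] at h1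
  exact le_of_mul_le_mul_right h1 hv0

theorem Matrix.IsHermitian.one_le_norm_mul_abs_eigenvalues {A B : Matrix ι ι ℝ}
    (hA : A.IsHermitian) (hBA : B * A = 1) (i : ι) : 1 ≤ ‖B‖ * |hA.eigenvalues i| := by
  set v : ι → ℝ := ⇑(hA.eigenvectorBasis i) with hv
  have hv0 : 0 < ‖v‖ := norm_pos_iff.2
    ((WithLp.ofLp_eq_zero 2).ne.2 <| hA.eigenvectorBasis.orthonormal.ne_zero i)
  have h1 := Matrix.linfty_opNorm_mulVec B (A *ᵥ v)
  rw [Matrix.mulVec_mulVec, hBA, one_mulVec, hv, hA.mulVec_eigenvectorBasis i, norm_smul, ← hv,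
    Real.norm_eq_abs, ← mul_assoc] at h1
  refine le_of_mul_le_mul_right ?_ hv0
  rwa [one_mul]

end MatrixAlgebra

/-! ### The connection Laplacian of a complex of dimension at most one -/

namespace FiniteComplex
open Matrix
open scoped Matrix.Norms.Operator

open Classical in
/-- The adjacency matrix of the inclusion graph of `G`. -/
noncomputable def incl (G : FiniteComplex.{u}) : Matrix G.Simplex G.Simplex ℝ :=
  G.inclusionGraph.adjMatrix ℝ

/-- The diagonal matrix with entry `1` at the vertices and `-1` at the other simplices. -/
noncomputable def sign (G : FiniteComplex.{u}) : Matrix G.Simplex G.Simplex ℝ :=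
  diagonal fun x => if x.1.card = 1 then 1 else -1

open Classical in
/-- The number of simplices which contain `x` or are contained in `x`, other than `x` itself. -/
noncomputable def deg (G : FiniteComplex.{u}) (x : G.Simplex) : ℕ :=
  G.inclusionGraph.degree x

/-- All simplices have at most two vertices. -/
def DimLeOne (G : FiniteComplex.{u}) : Prop := ∀ x ∈ G.complex.faces, x.card ≤ 2

variable {G : FiniteComplex.{u}}

theorem card_pos (x : G.Simplex) : 0 < x.1.card :=
  Finset.card_pos.2 (G.complex.isRelLowerSet_faces x.2).1

theorem singleton_mem_faces {x : G.Simplex} {v : G.V} (hv : v ∈ x.1) : {v} ∈ G.complex.faces :=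
  ((G.complex.isRelLowerSet_faces x.2).2 (Finset.singleton_subset_iff.2 hv)
    (Finset.singleton_nonempty v))

theorem inclusionGraph_adj {x y : G.Simplex} :
    G.inclusionGraph.Adj x y ↔ x ≠ y ∧ (x.1 ⊆ y.1 ∨ y.1 ⊆ x.1) := by
  rw [inclusionGraph, SimpleGraph.fromRel_adj]

theorem DimLeOne.card_eq (hG : G.DimLeOne) (x : G.Simplex) : x.1.card = 1 ∨ x.1.card = 2 := by
  have := hG x.1 x.2
  have := card_pos x
  omega

theorem DimLeOne.card_add_card_of_adj (hG : G.DimLeOne) {x y : G.Simplex}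
    (h : G.inclusionGraph.Adj x y) : x.1.card + y.1.card = 3 := by
  obtain ⟨hne, h⟩ := inclusionGraph_adj.1 h
  have hlt : x.1.card < y.1.card ∨ y.1.card < x.1.card := by
    rcases h with h | h
    · exact Or.inl (Finset.card_lt_card (h.ssubset_of_ne fun e => hne (Subtype.ext e)))
    · exact Or.inr (Finset.card_lt_card (h.ssubset_of_ne fun e => hne (Subtype.ext e.symm)))
  rcases hG.card_eq x with hx | hx <;> rcases hG.card_eq y with hy | hy <;> omega

theorem sign_mul_sign (G : FiniteComplex.{u}) : G.sign * G.sign = 1 := by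
  rw [sign, diagonal_mul_diagonal, ← diagonal_one]
  congr 1
  ext x
  split_ifs <;> simp

theorem DimLeOne.sign_mul_incl (hG : G.DimLeOne) : G.sign * G.incl = -(G.incl * G.sign) := by
  ext x y
  rw [sign, diagonal_mul, neg_apply, mul_diagonal, incl, SimpleGraph.adjMatrix_apply]
  by_cases h : G.inclusionGraph.Adj x y
  · have hc := hG.card_add_card_of_adj h
    rcases hG.card_eq x with hx | hx
    · have hy : y.1.card = 2 := by omega
      simp [h, hx, hy]
    · have hy : y.1.card = 1 := by omega
      simp [h, hx, hy]
  · simp [h]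

/-- The squared adjacency matrix commutes with the sign matrix, hence it is block diagonal. -/
theorem DimLeOne.incl_sq_apply_eq_zero (hG : G.DimLeOne) {x y : G.Simplex}
    (h : x.1.card ≠ y.1.card) : (G.incl ^ 2) x y = 0 := by
  have hc := congrFun (congrFun (commute_sq_of_anticommute hG.sign_mul_incl).eq x) y
  rw [sign, diagonal_mul, mul_diagonal] at hc
  rcases hG.card_eq x with hx | hx <;> rcases hG.card_eq y with hy | hy <;>
    simp [hx, hy] at hc h ⊢ <;> linarith

open Classical in
theorem incl_sq_apply (x y : G.Simplex) : (G.incl ^ 2) x y =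
    (Finset.univ.filter fun z => G.inclusionGraph.Adj z x ∧ G.inclusionGraph.Adj z y).card := by
  rw [pow_two, mul_apply, Finset.card_filter, Nat.cast_sum]
  refine Finset.sum_congr rfl fun z _ => ?_
  simp only [incl, SimpleGraph.adjMatrix_apply, SimpleGraph.adj_comm _ x z]
  by_cases h1 : G.inclusionGraph.Adj z x <;> by_cases h2 : G.inclusionGraph.Adj z y <;>
    simp [h1, h2]

theorem incl_sq_apply_self (x : G.Simplex) : (G.incl ^ 2) x x = G.deg x := by
  classical
  rw [pow_two, incl, SimpleGraph.adjMatrix_mul_self_apply_self, deg]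

theorem adj_singleton_iff {x y : G.Simplex} {v : G.V} (hx : x.1 = {v}) (hy : y.1.card = 2) :
    G.inclusionGraph.Adj x y ↔ v ∈ y.1 := by
  rw [inclusionGraph_adj, hx, Finset.singleton_subset_iff]
  refine ⟨fun ⟨_, h⟩ => h.resolve_right fun h => ?_, fun h => ⟨fun e => ?_, Or.inl h⟩⟩
  · have := Finset.card_le_card h
    rw [Finset.card_singleton] at this
    omega
  · rw [← e, hx, Finset.card_singleton] at hy
    omega

open Classical in
theorem DimLeOne.incl_sq_apply_edge (hG : G.DimLeOne) {x y : G.Simplex} (hx : x.1.card = 2)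
    (hy : y.1.card = 2) : (G.incl ^ 2) x y = (x.1 ∩ y.1).card := by
  rw [incl_sq_apply, Nat.cast_inj]
  refine (Finset.card_bij (fun v hv =>
    (⟨{v}, singleton_mem_faces (Finset.mem_inter.1 hv).1⟩ : G.Simplex)) ?_ ?_ ?_).symm
  · intro v hv
    rw [Finset.mem_filter_univ, adj_singleton_iff rfl hx, adj_singleton_iff rfl hy]
    exact Finset.mem_inter.1 hv
  · intro v _ w _ h
    exact Finset.singleton_injective (Subtype.ext_iff.1 h)
  · intro z hz
    rw [Finset.mem_filter_univ] at hz
    have hc := hG.card_add_card_of_adj hz.1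
    obtain ⟨v, hv⟩ := Finset.card_eq_one.1 (by omega : z.1.card = 1)
    rw [adj_singleton_iff hv hx, adj_singleton_iff hv hy] at hz
    exact ⟨v, Finset.mem_inter.2 hz, Subtype.ext hv.symm⟩

theorem DimLeOne.deg_edge (hG : G.DimLeOne) {x : G.Simplex} (hx : x.1.card = 2) :
    G.deg x = 2 := by
  classical
  have := hG.incl_sq_apply_edge hx hx
  rw [incl_sq_apply_self, Finset.inter_self, hx] at this
  exact_mod_cast this

/-- The off-diagonal blocks of `L` are those of `N`, the vertex block is the identity, and the edge
block counts common vertices, except that an edge has two vertices in common with itself. -/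
theorem DimLeOne.connectionLaplacian_eq (hG : G.DimLeOne) :
    G.connectionLaplacian = connectionForm G.incl G.sign := by
  classical
  ext x y
  have hS : G.sign x y = if x = y then (if x.1.card = 1 then 1 else -1) else 0 := by
    rw [sign, diagonal_apply]
  have hN : G.incl x y = if G.inclusionGraph.Adj x y then 1 else 0 := by
    rw [incl, SimpleGraph.adjMatrix_apply]
  have hform : connectionForm G.incl G.sign x y = G.incl x y + G.sign x y +
      (1 / 2) * ((1 - if x.1.card = 1 then 1 else -1) * (G.incl ^ 2) x y) := by
    rw [connectionForm, sub_mul, one_mul, sign, Matrix.add_apply, Matrix.add_apply,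
      Matrix.smul_apply, Matrix.sub_apply,
      diagonal_mul, smul_eq_mul]
    ring
  rw [hform, hN, hS, connectionLaplacian, of_apply]
  rcases hG.card_eq x with hx | hx
  · obtain ⟨v, hv⟩ := Finset.card_eq_one.1 hx
    by_cases hxy : x = y
    · subst hxy
      simp [hv]
    · rcases hG.card_eq y with hy | hy
      · obtain ⟨w, hw⟩ := Finset.card_eq_one.1 hy
        have hvw : v ≠ w := fun h => hxy (Subtype.ext (by rw [hv, hw, h]))
        have hadj : ¬ G.inclusionGraph.Adj x y := fun h => by
          have := hG.card_add_card_of_adj h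
          omega
        simp [hxy, hadj, hv, hw, hvw]
      · by_cases hvy : v ∈ y.1 <;>
          simp [hxy, adj_singleton_iff hv hy, hv, hvy, Finset.singleton_inter_of_mem,
            Finset.singleton_inter_of_notMem]
  · rcases hG.card_eq y with hy | hy
    · obtain ⟨w, hw⟩ := Finset.card_eq_one.1 hy
      have hxy : x ≠ y := fun h => by rw [h] at hx; omega
      rw [hG.incl_sq_apply_eq_zero (by omega), SimpleGraph.adj_comm]
      by_cases hwx : w ∈ x.1 <;>
          simp [hxy, adj_singleton_iff hw hx, hw, hwx, Finset.inter_singleton_of_mem,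
            Finset.inter_singleton_of_notMem]
    · have hadj : ¬ G.inclusionGraph.Adj x y := fun h => by
        have := hG.card_add_card_of_adj h
        omega
      rw [hG.incl_sq_apply_edge hx hy]
      by_cases hxy : x = y
      · subst hxy
        have hne : x.1.Nonempty := Finset.card_pos.1 (card_pos x)
        simp [hx, hne]
        norm_num
      · by_cases hne : (x.1 ∩ y.1).Nonempty
        · have h1 : (x.1 ∩ y.1).card < 2 := by
            by_contra hge
            have h2 : x.1 ∩ y.1 = x.1 :=
              Finset.eq_of_subset_of_card_le Finset.inter_subset_left (by omega)
            have h3 : x.1 ∩ y.1 = y.1 :=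
              Finset.eq_of_subset_of_card_le Finset.inter_subset_right (by omega)
            exact hxy (Subtype.ext (h2.symm.trans h3))
          have h2 : (x.1 ∩ y.1).card = 1 := by
            have := Finset.card_pos.2 hne
            omega
          simp [hx, hxy, hadj, hne, h2]
          norm_num
        · rw [Finset.not_nonempty_iff_eq_empty] at hne
          simp [hxy, hadj, hne]

theorem norm_sign_le (G : FiniteComplex.{u}) : ‖G.sign‖ ≤ 1 := by
  rw [sign, linfty_opNorm_diagonal, pi_norm_le_iff_of_nonneg zero_le_one]
  intro x
  split_ifs <;> simp

/-- In the operator norm for the supremum norm, `‖N‖` is the maximal degree. -/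
theorem norm_incl_le {R : ℝ} (hR : 0 ≤ R) (h : ∀ x, (G.deg x : ℝ) ≤ R) : ‖G.incl‖ ≤ R := by
  classical
  lift R to NNReal using hR
  rw [linfty_opNorm_def, NNReal.coe_le_coe]
  refine Finset.sup_le fun x _ => ?_
  rw [← NNReal.coe_le_coe, NNReal.coe_sum]
  refine le_trans (le_of_eq ?_) (h x)
  simp only [coe_nnnorm, incl, SimpleGraph.adjMatrix_apply, deg]
  rw [← SimpleGraph.card_neighborFinset_eq_degree, SimpleGraph.neighborFinset_eq_filter,
    Finset.card_filter, Nat.cast_sum]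
  refine Finset.sum_congr rfl fun y _ => ?_
  split_ifs <;> simp

end FiniteComplex

/-! ### Barycentric refinement -/

namespace FiniteComplex
open Matrix
open scoped Matrix.Norms.Operator

variable {G : FiniteComplex.{u}}

/-- The vertex of the Barycentric refinement given by a simplex. -/
def vtx (w : G.Simplex) : G.refine.Simplex :=
  ⟨({w} : Finset G.Simplex), Finset.singleton_nonempty w, by simp⟩

theorem vtx_injective : Function.Injective (vtx : G.Simplex → G.refine.Simplex) :=
  fun _ _ h => Finset.singleton_injective (Subtype.ext_iff.1 h)

theorem vtx_card (w : G.Simplex) : (vtx w).1.card = 1 := Finset.card_singleton _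

theorem exists_eq_vtx {x : G.refine.Simplex} (hx : x.1.card = 1) : ∃ w : G.Simplex, x = vtx w := by
  obtain ⟨w, hw⟩ := Finset.card_eq_one.1 hx
  exact ⟨w, Subtype.ext hw⟩

/-- The edge of the Barycentric refinement given by two incident simplices. -/
noncomputable def flag {w u : G.Simplex} (h : G.inclusionGraph.Adj w u) : G.refine.Simplex :=
  ⟨({w, u} : Finset G.Simplex), Finset.insert_nonempty _ _, by
    rw [Finset.coe_pair, SimpleGraph.isClique_pair]
    exact fun _ => h⟩

theorem flag_card {w u : G.Simplex} (h : G.inclusionGraph.Adj w u) : (flag h).1.card = 2 :=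
  Finset.card_pair (α := G.Simplex) h.ne

/-- Simplices of the refinement are chains of simplices, and incident simplices differ in
dimension. -/
theorem DimLeOne.refine (hG : G.DimLeOne) : G.refine.DimLeOne := by
  intro (c : Finset G.Simplex) hc
  have hcl : G.inclusionGraph.IsClique (c : Set G.Simplex) := hc.2
  by_contra hlt
  obtain ⟨x, hx, y, hy, z, hz, hxy, hxz, hyz⟩ := Finset.two_lt_card.1 (not_le.1 hlt)
  have h1 := hG.card_add_card_of_adj (hcl hx hy hxy)
  have h2 := hG.card_add_card_of_adj (hcl hx hz hxz)
  have h3 := hG.card_add_card_of_adj (hcl hy hz hyz)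
  omega

theorem exists_eq_flag {x : G.refine.Simplex} (hx : x.1.card = 2) {w : G.Simplex}
    (hw : {w} ⊆ x.1) :
    ∃ (u : G.Simplex) (h : G.inclusionGraph.Adj w u), x = flag h := by
  obtain ⟨(c : Finset G.Simplex), hc⟩ := x
  have hcl : G.inclusionGraph.IsClique (c : Set G.Simplex) := hc.2
  have hwc : w ∈ c := Finset.singleton_subset_iff.1 hw
  obtain ⟨a, b, hab, rfl⟩ := Finset.card_eq_two.1 (show c.card = 2 from hx)
  have hadj : G.inclusionGraph.Adj a b := hcl (by simp) (by simp) hab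
  rcases Finset.mem_insert.1 hwc with rfl | hw
  · exact ⟨b, hadj, rfl⟩
  · rw [Finset.mem_singleton] at hw
    subst hw
    exact ⟨a, hadj.symm, Subtype.ext (Finset.pair_comm (α := G.Simplex) _ _)⟩

theorem adj_vtx_flag {w a b : G.Simplex} (h : G.inclusionGraph.Adj a b) :
    G.refine.inclusionGraph.Adj (vtx w) (flag h) ↔ w = a ∨ w = b := by
  rw [adj_singleton_iff rfl (flag_card h)]
  change w ∈ ({a, b} : Finset G.Simplex) ↔ _
  simp

theorem DimLeOne.adj_vtx_iff (hG : G.DimLeOne) {w : G.Simplex} {z : G.refine.Simplex} :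
    G.refine.inclusionGraph.Adj (vtx w) z ↔
      ∃ (u : G.Simplex) (h : G.inclusionGraph.Adj w u), z = flag h := by
  refine ⟨fun h => ?_, ?_⟩
  · have hc := hG.refine.card_add_card_of_adj h
    rw [vtx_card] at hc
    have hz : z.1.card = 2 := by omega
    exact exists_eq_flag hz (Finset.singleton_subset_iff.2 ((adj_singleton_iff rfl hz).1 h))
  · rintro ⟨u, h, rfl⟩
    exact (adj_vtx_flag h).2 (Or.inl rfl)

theorem DimLeOne.deg_vtx (hG : G.DimLeOne) (w : G.Simplex) : G.refine.deg (vtx w) = G.deg w := by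
  classical
  rw [deg, deg, ← SimpleGraph.card_neighborFinset_eq_degree,
    ← SimpleGraph.card_neighborFinset_eq_degree]
  refine (Finset.card_bij (fun u hu => flag ((SimpleGraph.mem_neighborFinset _ _ _).1 hu))
    ?_ ?_ ?_).symm
  · intro u hu
    rw [SimpleGraph.mem_neighborFinset]
    exact (adj_vtx_flag _).2 (Or.inl rfl)
  · intro u hu v hv h
    have h1 : ({w, u} : Finset G.Simplex) = {w, v} := Subtype.ext_iff.1 h
    have h2 : u ∈ ({w, v} : Finset G.Simplex) := h1 ▸ (by simp)
    rw [SimpleGraph.mem_neighborFinset] at hu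
    simpa [hu.ne'] using h2
  · intro z hz
    rw [SimpleGraph.mem_neighborFinset, hG.adj_vtx_iff] at hz
    obtain ⟨u, h, rfl⟩ := hz
    exact ⟨u, (SimpleGraph.mem_neighborFinset _ _ _).2 h, rfl⟩

/-- On the vertices of the refinement, the square of the adjacency matrix is the sign-less
Kirchhoff Laplacian of the inclusion graph. -/
theorem DimLeOne.incl_sq_vtx (hG : G.DimLeOne) (u w : G.Simplex) :
    (G.refine.incl ^ 2) (vtx u) (vtx w) = (diagonal (fun x => (G.deg x : ℝ)) + G.incl) u w := by
  classical
  rw [Matrix.add_apply, diagonal_apply]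
  by_cases huw : u = w
  · subst huw
    rw [incl_sq_apply_self, hG.deg_vtx, if_pos rfl, incl, SimpleGraph.adjMatrix_apply,
      if_neg (SimpleGraph.irrefl _), add_zero]
  · rw [incl_sq_apply, if_neg huw, zero_add, incl, SimpleGraph.adjMatrix_apply]
    by_cases h : G.inclusionGraph.Adj u w
    · rw [if_pos h, Nat.cast_eq_one, Finset.card_eq_one]
      refine ⟨flag h, ?_⟩
      ext z
      rw [Finset.mem_filter_univ, Finset.mem_singleton]
      constructor
      · rintro ⟨h1, h2⟩
        obtain ⟨v, hv, rfl⟩ := hG.adj_vtx_iff.1 h1.symm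
        rcases (adj_vtx_flag hv).1 h2.symm with h3 | h3
        · exact absurd h3.symm huw
        · subst h3; rfl
      · rintro rfl
        exact ⟨((adj_vtx_flag h).2 (Or.inl rfl)).symm, ((adj_vtx_flag h).2 (Or.inr rfl)).symm⟩
    · rw [if_neg h, Nat.cast_eq_zero, Finset.card_eq_zero, Finset.filter_eq_empty_iff]
      rintro z - ⟨h1, h2⟩
      obtain ⟨v, hv, rfl⟩ := hG.adj_vtx_iff.1 h1.symm
      rcases (adj_vtx_flag hv).1 h2.symm with h3 | h3
      · exact huw h3.symm
      · exact h (h3 ▸ hv)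

/-- The matrix of the inclusion of the vertices of the refinement into its simplices. -/
noncomputable def vtxMatrix (G : FiniteComplex.{u}) : Matrix G.refine.Simplex G.Simplex ℝ :=
  Matrix.of fun x w => if x = vtx w then 1 else 0

theorem vtxMatrix_transpose_mul (G : FiniteComplex.{u}) : G.vtxMatrixᵀ * G.vtxMatrix = 1 := by
  ext u w
  simp only [mul_apply, vtxMatrix, transpose_apply, of_apply, ite_mul, one_mul, zero_mul,
    Finset.sum_ite_eq', Finset.mem_univ, if_true]
  rw [one_apply]
  simp only [vtx_injective.eq_iff]

theorem mul_vtxMatrix_apply (M : Matrix G.refine.Simplex G.refine.Simplex ℝ)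
    (x : G.refine.Simplex) (w : G.Simplex) : (M * G.vtxMatrix) x w = M x (vtx w) := by
  simp [mul_apply, vtxMatrix]

theorem vtxMatrix_mul_apply_vtx {κ : Type*} (M : Matrix G.Simplex κ ℝ) (u : G.Simplex) (w : κ) :
    (G.vtxMatrix * M) (vtx u) w = M u w := by
  simp [mul_apply, vtxMatrix, vtx_injective.eq_iff]

theorem vtxMatrix_mul_apply_of_card {κ : Type*} (M : Matrix G.Simplex κ ℝ) {x : G.refine.Simplex}
    (hx : x.1.card ≠ 1) (w : κ) : (G.vtxMatrix * M) x w = 0 := by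
  have : ∀ u, x ≠ vtx u := fun u h => hx (h ▸ vtx_card u)
  simp [mul_apply, vtxMatrix, this]

theorem vtxMatrix_mul_transpose (G : FiniteComplex.{u}) :
    G.vtxMatrix * G.vtxMatrixᵀ = (1 / 2 : ℝ) • (1 + G.refine.sign) := by
  ext x y
  rw [Matrix.smul_apply, Matrix.add_apply, one_apply, sign, diagonal_apply, smul_eq_mul]
  by_cases hx : x.1.card = 1
  · obtain ⟨u, rfl⟩ := exists_eq_vtx hx
    rw [vtxMatrix_mul_apply_vtx, transpose_apply, vtxMatrix, of_apply]
    by_cases h : y = vtx u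
    · subst h; simp [hx]; norm_num
    · simp [h, Ne.symm h]
  · rw [vtxMatrix_mul_apply_of_card _ hx]
    by_cases h : x = y <;> simp [h]
    subst h
    simp [hx]

theorem DimLeOne.incl_sq_mul_vtxMatrix (hG : G.DimLeOne) :
    G.refine.incl ^ 2 * G.vtxMatrix =
      G.vtxMatrix * (diagonal (fun x => (G.deg x : ℝ)) + G.incl) := by
  ext x w
  rw [mul_vtxMatrix_apply]
  by_cases hx : x.1.card = 1
  · obtain ⟨u, rfl⟩ := exists_eq_vtx hx
    rw [vtxMatrix_mul_apply_vtx, hG.incl_sq_vtx]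
  · rw [vtxMatrix_mul_apply_of_card _ hx, hG.refine.incl_sq_apply_eq_zero]
    rwa [vtx_card]

open Polynomial in
/-- The spectral renormalization: up to the contribution of the constant term, moments of the
refinement are twice the moments of the sign-less Kirchhoff Laplacian of the inclusion graph. The
supertrace makes vertices and edges contribute equally, and `vtxMatrix` intertwines the vertex part
with the Laplacian. -/
theorem DimLeOne.trace_aeval_incl_sq_refine (hG : G.DimLeOne) (p : ℝ[X]) :
    (aeval (G.refine.incl ^ 2) p).trace =
      2 * (aeval (diagonal (fun x => (G.deg x : ℝ)) + G.incl) p).trace -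
        p.coeff 0 * G.refine.sign.trace := by
  set A := G.refine.incl ^ 2 with hA
  set B := diagonal (fun x => (G.deg x : ℝ)) + G.incl with hB
  have h1 : aeval A p * G.vtxMatrix = G.vtxMatrix * aeval B p := by
    induction p using Polynomial.induction_on' with
    | add p q hp hq => rw [map_add, map_add, Matrix.add_mul, Matrix.mul_add, hp, hq]
    | monomial n r =>
      have hn : A ^ n * G.vtxMatrix = G.vtxMatrix * B ^ n := by
        induction n with
        | zero => rw [pow_zero, pow_zero, Matrix.one_mul, Matrix.mul_one]
        | succ n ih =>
          rw [pow_succ, Matrix.mul_assoc, hG.incl_sq_mul_vtxMatrix, ← Matrix.mul_assoc, ih,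
            Matrix.mul_assoc, pow_succ]
      rw [aeval_monomial, aeval_monomial, Algebra.algebraMap_eq_smul_one,
        Algebra.algebraMap_eq_smul_one, smul_mul_assoc, smul_mul_assoc, one_mul, one_mul,
        Matrix.smul_mul, Matrix.mul_smul, hn]
  have h2 : (aeval B p).trace =
      (1 / 2) * ((aeval A p).trace + (G.refine.sign * aeval A p).trace) := by
    calc (aeval B p).trace = (G.vtxMatrixᵀ * (G.vtxMatrix * aeval B p)).trace := by
          rw [← Matrix.mul_assoc, vtxMatrix_transpose_mul, Matrix.one_mul]
      _ = (G.vtxMatrix * G.vtxMatrixᵀ * aeval A p).trace := by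
          rw [← h1, ← Matrix.mul_assoc, trace_mul_comm, Matrix.mul_assoc]
      _ = _ := by
          rw [vtxMatrix_mul_transpose, smul_mul_assoc, trace_smul, add_mul, one_mul, trace_add,
            smul_eq_mul]
  rw [hA, trace_involution_mul_aeval_sq hG.refine.sign_mul_incl, ← hA] at h2
  linarith

/-- The number of simplices whose degree in the inclusion graph is not `2`. -/
noncomputable def branchCount (G : FiniteComplex.{u}) : ℕ :=
  (Finset.univ.filter fun x : G.Simplex => G.deg x ≠ 2).card

/-- New simplices have degree two, and a simplex of `G` keeps its degree as a vertex. -/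
theorem DimLeOne.branchCount_refine_le (hG : G.DimLeOne) :
    G.refine.branchCount ≤ G.branchCount := by
  classical
  rw [branchCount, branchCount]
  refine (Finset.card_le_card (t := (Finset.univ.filter fun x : G.Simplex => G.deg x ≠ 2).image vtx)
    fun x hx => ?_).trans Finset.card_image_le
  rw [Finset.mem_filter_univ] at hx
  rcases hG.refine.card_eq x with h | h
  · obtain ⟨w, rfl⟩ := exists_eq_vtx h
    rw [hG.deg_vtx] at hx
    exact Finset.mem_image_of_mem _ (Finset.mem_filter.2 ⟨Finset.mem_univ _, hx⟩)
  · exact absurd (hG.refine.deg_edge h) hx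

theorem DimLeOne.deg_refine_le (hG : G.DimLeOne) {Δ : ℕ} (hΔ : 2 ≤ Δ) (h : ∀ x, G.deg x ≤ Δ)
    (x : G.refine.Simplex) : G.refine.deg x ≤ Δ := by
  rcases hG.refine.card_eq x with hx | hx
  · obtain ⟨w, rfl⟩ := exists_eq_vtx hx
    rw [hG.deg_vtx]
    exact h w
  · rw [hG.refine.deg_edge hx]
    exact hΔ

theorem trace_incl (G : FiniteComplex.{u}) : G.incl.trace = 0 := by
  classical
  rw [incl, SimpleGraph.trace_adjMatrix]

/-- The trace is four times the number of edges, which is here expressed by the number of simplices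
and the Euler characteristic. -/
theorem DimLeOne.trace_incl_sq (hG : G.DimLeOne) :
    (G.incl ^ 2).trace = 2 * (G.size - G.sign.trace) := by
  have h1 := trace_involution_mul_aeval_sq hG.sign_mul_incl Polynomial.X
  rw [Polynomial.aeval_X, Polynomial.coeff_X_zero, zero_mul] at h1
  have h2 : (G.incl ^ 2).trace - (G.sign * G.incl ^ 2).trace = 2 * (G.size - G.sign.trace) := by
    have h3 : (G.size : ℝ) = ∑ _x : G.Simplex, (1 : ℝ) := by simp [size]
    rw [h3, sign, trace_diagonal, Matrix.trace, Matrix.trace, ← Finset.sum_sub_distrib,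
      ← Finset.sum_sub_distrib, Finset.mul_sum]
    refine Finset.sum_congr rfl fun x _ => ?_
    rw [diag_apply, diag_apply, diagonal_mul, incl_sq_apply_self]
    rcases hG.card_eq x with hx | hx
    · simp [hx]
    · rw [hG.deg_edge hx, if_neg (by omega)]
      norm_num
  linarith

/-- Comparing the renormalization for `p = 1` and `p = X` gives the size of the refinement and the
invariance of the Euler characteristic. -/
theorem DimLeOne.size_refine (hG : G.DimLeOne) :
    (G.refine.size : ℝ) = 2 * G.size - G.sign.trace ∧ G.refine.sign.trace = G.sign.trace := by
  have h1 := hG.trace_aeval_incl_sq_refine 1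
  have h2 := hG.trace_aeval_incl_sq_refine Polynomial.X
  simp only [map_one, trace_one, Polynomial.coeff_one_zero, one_mul, Polynomial.aeval_X,
    Polynomial.coeff_X_zero, zero_mul, sub_zero, trace_add, trace_incl, add_zero, trace_diagonal]
    at h1 h2
  have h3 : ∑ x, (G.deg x : ℝ) = (G.incl ^ 2).trace := by
    rw [Matrix.trace]
    exact Finset.sum_congr rfl fun x _ => by rw [diag_apply, incl_sq_apply_self]
  rw [h3, hG.trace_incl_sq, hG.refine.trace_incl_sq] at h2
  change (G.refine.size : ℝ) = 2 * (G.size : ℝ) - _ at h1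
  constructor <;> linarith

end FiniteComplex

/-! ### The limiting density of states -/

section LimitFunctional
open Polynomial

/-- The integral of `p` with respect to the limiting density of states. -/
noncomputable def momentIntegral (p : ℝ[X]) : ℝ :=
  ∫ x in (0 : ℝ)..1, p.eval (4 * Real.sin (Real.pi * x) ^ 2)

theorem momentIntegral_add (p q : ℝ[X]) :
    momentIntegral (p + q) = momentIntegral p + momentIntegral q := by
  simp only [momentIntegral, eval_add]
  apply intervalIntegral.integral_add <;> apply Continuous.intervalIntegrable <;> fun_prop

theorem momentIntegral_C_mul (c : ℝ) (p : ℝ[X]) :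
    momentIntegral (C c * p) = c * momentIntegral p := by
  simp only [momentIntegral, eval_mul, eval_C, intervalIntegral.integral_const_mul]

theorem four_mul_sin_sq_sub_two (x : ℝ) :
    4 * Real.sin (Real.pi * x) ^ 2 - 2 = -2 * Real.cos (2 * Real.pi * x) := by
  have h := Real.cos_two_mul (Real.pi * x)
  have h2 := Real.sin_sq_add_cos_sq (Real.pi * x)
  rw [show 2 * Real.pi * x = 2 * (Real.pi * x) by ring, h]
  linear_combination 4 * h2

/-- The limiting density of states is symmetric about `2`: the integrand changes sign under
`x ↦ x + 1 / 2`. -/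
theorem momentIntegral_odd (j : ℕ) : momentIntegral ((X - C 2) ^ (2 * j + 1)) = 0 := by
  set h : ℝ → ℝ := fun x => (4 * Real.sin (Real.pi * x) ^ 2 - 2) ^ (2 * j + 1) with hh
  have hI : momentIntegral ((X - C 2) ^ (2 * j + 1)) = ∫ x in (0 : ℝ)..1, h x := by
    simp [momentIntegral, hh]
  have hper : Function.Periodic h 1 := fun x => by
    simp only [hh, four_mul_sin_sq_sub_two]
    rw [show 2 * Real.pi * (x + 1) = 2 * Real.pi * x + 2 * Real.pi by ring, Real.cos_add_two_pi]
  have hanti : ∀ x, h (x + 1 / 2) = -h x := fun x => by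
    simp only [hh, four_mul_sin_sq_sub_two]
    rw [show 2 * Real.pi * (x + 1 / 2) = 2 * Real.pi * x + Real.pi by ring, Real.cos_add_pi,
      mul_neg, Odd.neg_pow ⟨j, rfl⟩]
  have h1 := hper.intervalIntegral_add_eq (1 / 2) 0
  have h2 : ∫ x in (0 : ℝ)..1, h (x + 1 / 2) = ∫ x in (1 / 2 : ℝ)..1 / 2 + 1, h x := by
    rw [intervalIntegral.integral_comp_add_right]
    congr 1 <;> norm_num
  simp only [hanti, intervalIntegral.integral_neg] at h2
  rw [zero_add] at h1
  rw [hI]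
  linarith

/-- The doubling map `y ↦ (y - 2)²` preserves the limiting density of states. -/
theorem momentIntegral_even (j : ℕ) :
    momentIntegral ((X - C 2) ^ (2 * j)) = momentIntegral (X ^ j) := by
  set h : ℝ → ℝ := fun x => (4 * Real.sin (Real.pi * x) ^ 2) ^ j with hh
  have hcont : Continuous h := by fun_prop
  have hI : momentIntegral (X ^ j) = ∫ x in (0 : ℝ)..1, h x := by
    simp [momentIntegral, hh]
  have hI2 : momentIntegral ((X - C 2) ^ (2 * j)) = ∫ x in (0 : ℝ)..1, h (2 * x + 1 / 2) := by
    simp only [momentIntegral, eval_pow, eval_sub, eval_X, eval_C, hh]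
    refine intervalIntegral.integral_congr fun x _ => ?_
    rw [pow_mul, four_mul_sin_sq_sub_two,
      show Real.pi * (2 * x + 1 / 2) = 2 * Real.pi * x + Real.pi / 2 by ring,
      Real.sin_add_pi_div_two]
    congr 1
    ring
  have hper : Function.Periodic h 1 := fun x => by
    simp only [hh]
    rw [mul_add, mul_one, Real.sin_add_pi, neg_sq]
  have h1 := hper.intervalIntegral_add_eq (1 / 2) 0
  have h2 := hper.intervalIntegral_add_eq (3 / 2) 0
  have h3 : ∫ x in (1 / 2 : ℝ)..5 / 2, h x =
      (∫ x in (1 / 2 : ℝ)..3 / 2, h x) + ∫ x in (3 / 2 : ℝ)..5 / 2, h x :=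
    (intervalIntegral.integral_add_adjacent_intervals (hcont.intervalIntegrable _ _)
      (hcont.intervalIntegrable _ _)).symm
  rw [hI, hI2, intervalIntegral.integral_comp_mul_add _ two_ne_zero]
  norm_num at h1 h2 ⊢
  rw [h3, h1, h2]
  ring

theorem fPlus_sq (y : ℝ) : fPlus y ^ 2 = 1 + y * fPlus y := by
  have h : √(y ^ 2 + 4) ^ 2 = y ^ 2 + 4 := Real.sq_sqrt (by positivity)
  rw [fPlus]
  linear_combination h / 4

theorem fMinus_sq (y : ℝ) : fMinus y ^ 2 = 1 + y * fMinus y := by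
  have h : √(y ^ 2 + 4) ^ 2 = y ^ 2 + 4 := Real.sq_sqrt (by positivity)
  rw [fMinus]
  linear_combination h / 4

theorem fPlus_add_fMinus (y : ℝ) : fPlus y + fMinus y = y := by
  rw [fPlus, fMinus]; ring

theorem fPlus_sq_mul_fMinus_sq (y : ℝ) : fPlus y ^ 2 * fMinus y ^ 2 = 1 := by
  have h : √(y ^ 2 + 4) ^ 2 = y ^ 2 + 4 := Real.sq_sqrt (by positivity)
  have h1 : fPlus y * fMinus y = -1 := by
    rw [fPlus, fMinus]
    linear_combination -h / 4
  rw [← mul_pow, h1]; norm_num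

@[fun_prop]
theorem continuous_fPlus : Continuous fPlus := by
  unfold fPlus; fun_prop

@[fun_prop]
theorem continuous_fMinus : Continuous fMinus := by
  unfold fMinus; fun_prop

theorem fPlus_sq_mem_Icc {y : ℝ} (h0 : 0 ≤ y) (h4 : y ≤ 4) : fPlus y ^ 2 ∈ Set.Icc 1 25 := by
  have h1 : √(y ^ 2 + 4) ≤ 6 := Real.sqrt_le_iff.2 ⟨by norm_num, by nlinarith⟩
  have h2 : 2 ≤ √(y ^ 2 + 4) := Real.le_sqrt_of_sq_le (by nlinarith)
  have h3 : 1 ≤ fPlus y := by rw [fPlus]; linarith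
  have h5 : fPlus y ≤ 5 := by rw [fPlus]; linarith
  constructor <;> nlinarith

theorem fMinus_sq_mem_Icc {y : ℝ} (h0 : 0 ≤ y) (h4 : y ≤ 4) :
    fMinus y ^ 2 ∈ Set.Icc (25⁻¹ : ℝ) 1 := by
  have h1 := fPlus_sq_mem_Icc h0 h4
  have h2 : fMinus y ^ 2 = (fPlus y ^ 2)⁻¹ :=
    eq_inv_of_mul_eq_one_right (fPlus_sq_mul_fMinus_sq y)
  rw [h2]
  exact ⟨inv_anti₀ (by linarith [h1.1]) h1.2, inv_le_one_of_one_le₀ h1.1⟩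

/-- The integral of `g` with respect to the limiting distribution of the eigenvalues of `L²`. -/
noncomputable def spectralIntegral (g : ℝ → ℝ) : ℝ :=
  ∫ x in (0 : ℝ)..1, (g (fPlus (4 * Real.sin (Real.pi * x) ^ 2) ^ 2) +
    g (fMinus (4 * Real.sin (Real.pi * x) ^ 2) ^ 2)) / 2

/-- The density of states of `L²` is that of `N²`, transported by the two branches. -/
theorem spectralIntegral_pow (j : ℕ) :
    spectralIntegral (fun y => y ^ (j + 1)) = momentIntegral (meanPowPoly (2 * j + 1)) := by
  refine intervalIntegral.integral_congr fun x _ => ?_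
  rw [eval_meanPowPoly (fPlus_sq _) (fMinus_sq _) (fPlus_add_fMinus _)]
  simp only [← pow_mul]
  rfl

theorem spectralIntegral_add {g h : ℝ → ℝ} (hg : Continuous g) (hh : Continuous h) :
    spectralIntegral (fun y => g y + h y) = spectralIntegral g + spectralIntegral h := by
  rw [spectralIntegral, spectralIntegral, spectralIntegral, ← intervalIntegral.integral_add]
  · refine intervalIntegral.integral_congr fun x _ => ?_
    ring
  all_goals apply Continuous.intervalIntegrable; fun_prop

theorem spectralIntegral_const_mul (c : ℝ) (g : ℝ → ℝ) :
    spectralIntegral (fun y => c * g y) = c * spectralIntegral g := by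
  rw [spectralIntegral, spectralIntegral, ← intervalIntegral.integral_const_mul]
  refine intervalIntegral.integral_congr fun x _ => ?_
  ring

theorem abs_spectralIntegral_sub_le {g h : ℝ → ℝ} (hg : Continuous g) (hh : Continuous h) {ε : ℝ}
    (H : ∀ y ∈ Set.Icc (25⁻¹ : ℝ) 25, |g y - h y| ≤ ε) :
    |spectralIntegral g - spectralIntegral h| ≤ ε := by
  rw [spectralIntegral, spectralIntegral, ← intervalIntegral.integral_sub, ← Real.norm_eq_abs]
  · have hb : ∀ x ∈ Set.uIoc (0 : ℝ) 1,
        ‖(g (fPlus (4 * Real.sin (Real.pi * x) ^ 2) ^ 2) +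
          g (fMinus (4 * Real.sin (Real.pi * x) ^ 2) ^ 2)) / 2 -
          (h (fPlus (4 * Real.sin (Real.pi * x) ^ 2) ^ 2) +
          h (fMinus (4 * Real.sin (Real.pi * x) ^ 2) ^ 2)) / 2‖ ≤ ε := by
      intro x _
      have h0 : 0 ≤ 4 * Real.sin (Real.pi * x) ^ 2 := by positivity
      have h4 : 4 * Real.sin (Real.pi * x) ^ 2 ≤ 4 := by
        nlinarith [Real.sin_sq_le_one (Real.pi * x)]
      have h1 := fPlus_sq_mem_Icc h0 h4
      have h2 := fMinus_sq_mem_Icc h0 h4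
      have e1 := abs_le.1 (H _ ⟨by linarith [h1.1], h1.2⟩)
      have e2 := abs_le.1 (H _ ⟨h2.1, by linarith [h2.2]⟩)
      rw [Real.norm_eq_abs, abs_le]
      constructor <;> linarith [e1.1, e1.2, e2.1, e2.2]
    simpa using intervalIntegral.norm_integral_le_of_norm_le_const hb
  all_goals apply Continuous.intervalIntegrable; fun_prop

end LimitFunctional

/-! ### Convergence of moments -/

namespace FiniteComplex
open Matrix Polynomial
open scoped Matrix.Norms.Operator

variable {G : FiniteComplex.{u}}

theorem refinement_succ (G : FiniteComplex.{u}) (n : ℕ) :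
    G.refinement (n + 1) = (G.refinement n).refine := by
  rw [refinement, Function.iterate_succ_apply', ← refinement]

theorem DimLeOne.refinement (hG : G.DimLeOne) (n : ℕ) : (G.refinement n).DimLeOne := by
  induction n with
  | zero => exact hG
  | succ n ih => rw [refinement_succ]; exact ih.refine

theorem DimLeOne.sign_trace_refinement (hG : G.DimLeOne) (n : ℕ) :
    (G.refinement n).sign.trace = G.sign.trace := by
  induction n with
  | zero => rfl
  | succ n ih => rw [refinement_succ, (hG.refinement n).size_refine.2, ih]

theorem DimLeOne.size_refinement (hG : G.DimLeOne) (n : ℕ) :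
    ((G.refinement n).size : ℝ) = G.sign.trace + 2 ^ n * (G.size - G.sign.trace) := by
  induction n with
  | zero => simp [FiniteComplex.refinement]
  | succ n ih =>
    rw [refinement_succ, (hG.refinement n).size_refine.1, hG.sign_trace_refinement, ih]
    ring

theorem DimLeOne.branchCount_refinement_le (hG : G.DimLeOne) (n : ℕ) :
    (G.refinement n).branchCount ≤ G.branchCount := by
  induction n with
  | zero => exact le_rfl
  | succ n ih => rw [refinement_succ]; exact (hG.refinement n).branchCount_refine_le.trans ih

theorem DimLeOne.exists_deg_refinement_le (hG : G.DimLeOne) :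
    ∃ Δ : ℕ, 2 ≤ Δ ∧ ∀ n x, (G.refinement n).deg x ≤ Δ := by
  refine ⟨max 2 (Finset.univ.sup G.deg), le_max_left _ _, fun n => ?_⟩
  induction n with
  | zero => exact fun x => (Finset.le_sup (f := G.deg) (Finset.mem_univ x)).trans (le_max_right _ _)
  | succ n ih =>
    rw [refinement_succ]
    exact (hG.refinement n).deg_refine_le (le_max_left _ _) ih

theorem sign_trace_lt_size {x : G.Simplex} (hx : x.1.card = 2) : G.sign.trace < G.size := by
  have h3 : (G.size : ℝ) = ∑ _x : G.Simplex, (1 : ℝ) := by simp [size]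
  rw [h3, sign, trace_diagonal]
  refine Finset.sum_lt_sum (fun y _ => ?_) ⟨x, Finset.mem_univ _, ?_⟩
  · split_ifs <;> norm_num
  · rw [if_neg (by omega)]; norm_num

theorem DimLeOne.tendsto_size (hG : G.DimLeOne) (h : G.sign.trace < G.size) :
    Tendsto (fun n => ((G.refinement n).size : ℝ)) atTop atTop := by
  simp only [hG.size_refinement]
  exact tendsto_atTop_add_const_left _ _
    ((tendsto_pow_atTop_atTop_of_one_lt one_lt_two).atTop_mul_const (sub_pos.2 h))

theorem DimLeOne.tendsto_size_ratio (hG : G.DimLeOne) (h : G.sign.trace < G.size) :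
    Tendsto (fun n => 2 * ((G.refinement n).size : ℝ) / (G.refinement (n + 1)).size) atTop
      (𝓝 1) := by
  have hs := (tendsto_add_atTop_iff_nat 1).2 (hG.tendsto_size h)
  have h1 : Tendsto (fun n => 1 + G.sign.trace / ((G.refinement (n + 1)).size : ℝ)) atTop
      (𝓝 (1 + 0)) := (hs.const_div_atTop _).const_add 1
  rw [add_zero] at h1
  refine h1.congr' ?_
  filter_upwards [hs.eventually_gt_atTop 0] with n hn
  have h2 : ((G.refinement (n + 1)).size : ℝ) = 2 * (G.refinement n).size - G.sign.trace := by
    rw [refinement_succ, (hG.refinement n).size_refine.1, hG.sign_trace_refinement]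
  field_simp
  linarith

/-- Recentered at `2`, the moments of a refinement are twice those of the adjacency matrix of the
previous complex, up to the effect of the boundedly many branch points. -/
theorem DimLeOne.exists_abs_trace_pow_sub_le (hG : G.DimLeOne) (k : ℕ) :
    ∃ c : ℝ, ∀ n, |(aeval ((G.refinement (n + 1)).incl ^ 2) ((X - C 2 : ℝ[X]) ^ k)).trace -
      2 * ((G.refinement n).incl ^ k).trace| ≤ c := by
  obtain ⟨Δ, hΔ2, hΔ⟩ := hG.exists_deg_refinement_le
  have hΔ2' : (2 : ℝ) ≤ Δ := by exact_mod_cast hΔ2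
  refine ⟨2 * (k * (Δ + Δ) ^ k * 1 * G.branchCount) + |(-2) ^ k * G.sign.trace|, fun n => ?_⟩
  set G' := G.refinement n with hG'
  have hG'1 : G'.DimLeOne := hG.refinement n
  rw [refinement_succ, ← hG', hG'1.trace_aeval_incl_sq_refine, hG'1.size_refine.2,
    hG.sign_trace_refinement]
  have hc : ((X - C (2 : ℝ)) ^ k).coeff 0 = (-2) ^ k := by
    rw [coeff_zero_eq_eval_zero]; simp
  set d : G'.Simplex → ℝ := fun x => (G'.deg x : ℝ) - 2 with hd
  have hA : aeval (diagonal (fun x => (G'.deg x : ℝ)) + G'.incl) ((X - C 2 : ℝ[X]) ^ k) =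
      (diagonal d + G'.incl) ^ k := by
    rw [map_pow, map_sub, aeval_X, aeval_C, add_sub_right_comm, algebraMap_eq_diagonal,
      diagonal_sub]
    rfl
  have hdle : ∀ x, |d x| ≤ Δ := fun x => by
    have h1 : (G'.deg x : ℝ) ≤ Δ := by exact_mod_cast hΔ n x
    have h2 : (0 : ℝ) ≤ G'.deg x := Nat.cast_nonneg _
    rw [hd, abs_le]
    constructor <;> linarith
  have hN : ‖G'.incl‖ ≤ Δ := norm_incl_le (by linarith) fun x => by exact_mod_cast hΔ n x
  have hD : ‖diagonal d‖ ≤ Δ := by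
    rw [linfty_opNorm_diagonal, pi_norm_le_iff_of_nonneg (by linarith)]
    exact hdle
  have h1 : ‖(1 : Matrix G'.Simplex G'.Simplex ℝ)‖ ≤ 1 := by
    rw [← diagonal_one, linfty_opNorm_diagonal, pi_norm_le_iff_of_nonneg zero_le_one]
    simp
  have hmain := abs_trace_pow_sub_le (A := diagonal d + G'.incl) (B := G'.incl) (d := d)
    (R := (Δ + Δ : ℝ)) ((norm_add_le _ _).trans (add_le_add hD hN)) (by linarith)
    (add_sub_cancel_right _ _) (fun x => (hdle x).trans (by linarith)) k 1
  rw [mul_one, trace_sub] at hmain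
  have hcard : ((Finset.univ.filter fun x => d x ≠ 0).card : ℝ) ≤ G.branchCount := by
    refine le_trans ?_ (Nat.cast_le.2 (hG.branchCount_refinement_le n))
    rw [branchCount, Nat.cast_le]
    refine Finset.card_le_card fun x hx => ?_
    rw [Finset.mem_filter_univ] at hx ⊢
    intro h
    apply hx
    change (G'.deg x : ℝ) - 2 = 0
    rw [show G'.deg x = 2 from h]
    norm_num
  have hmain' : |((diagonal d + G'.incl) ^ k).trace - (G'.incl ^ k).trace| ≤
      k * (Δ + Δ) ^ k * 1 * G.branchCount := by
    refine hmain.trans ?_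
    gcongr
  rw [hA, hc]
  calc |2 * ((diagonal d + G'.incl) ^ k).trace - (-2) ^ k * G.sign.trace -
        2 * (G'.incl ^ k).trace|
      = |2 * (((diagonal d + G'.incl) ^ k).trace - (G'.incl ^ k).trace) -
          (-2) ^ k * G.sign.trace| := by ring_nf
    _ ≤ |2 * (((diagonal d + G'.incl) ^ k).trace - (G'.incl ^ k).trace)| +
          |(-2) ^ k * G.sign.trace| := abs_sub _ _
    _ ≤ _ := by
        rw [abs_mul, abs_of_nonneg (zero_le_two : (0 : ℝ) ≤ 2)]
        gcongr

/-- The moments are computed by strong induction on the degree in `X - 2`: one refinement step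
reduces `(X - 2) ^ (2 j)` to `X ^ j`. -/
theorem DimLeOne.tendsto_trace_aeval_incl_sq (hG : G.DimLeOne) (h : G.sign.trace < G.size)
    (p : ℝ[X]) :
    Tendsto (fun n => (aeval ((G.refinement n).incl ^ 2) p).trace / (G.refinement n).size) atTop
      (𝓝 (momentIntegral p)) := by
  set P : ℝ[X] → Prop := fun p => Tendsto (fun n =>
    (aeval ((G.refinement n).incl ^ 2) p).trace / (G.refinement n).size) atTop
      (𝓝 (momentIntegral p)) with hP
  have hadd : ∀ p q, P p → P q → P (p + q) := fun p q hp hq => by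
    simp only [hP, map_add, trace_add, add_div, momentIntegral_add]
    exact hp.add hq
  have hmul : ∀ c p, P p → P (C c * p) := fun c p hp => by
    simp only [hP, map_mul, aeval_C, Algebra.algebraMap_eq_smul_one, smul_mul_assoc, one_mul,
      trace_smul, smul_eq_mul, mul_div_assoc, momentIntegral_C_mul]
    exact hp.const_mul c
  -- Recentering at `2` turns powers into combinations of powers of the same or lower degree.
  have hcomp : ∀ (q : ℝ[X]) (m : ℕ), q.natDegree < m → (∀ i < m, P ((X - C 2) ^ i)) →
      P (q.comp (X - C 2)) := by
    intro q m hm hi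
    have hz : P 0 := by simpa using hmul 0 _ (hi 0 (by omega))
    rw [comp_eq_sum_left, sum_over_range' _ (by simp) m hm]
    exact Finset.sum_induction _ P hadd hz fun i hi' => hmul _ _ (hi i (Finset.mem_range.1 hi'))
  have hshift : ∀ q : ℝ[X], (q.comp (X + C 2)).comp (X - C 2) = q := fun q => by
    rw [comp_assoc]; simp
  have hnd : ∀ q : ℝ[X], (q.comp (X + C 2)).natDegree = q.natDegree := fun q => by
    rw [natDegree_comp, natDegree_X_add_C, mul_one]
  have hs := (tendsto_add_atTop_iff_nat 1).2 (hG.tendsto_size h)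
  have hpow : ∀ k, P ((X - C 2) ^ k) := by
    intro k
    induction k using Nat.strong_induction_on with
    | _ k ih =>
    have hN : Tendsto (fun n => ((G.refinement n).incl ^ k).trace / (G.refinement n).size) atTop
        (𝓝 (momentIntegral ((X - C 2) ^ k))) := by
      obtain ⟨j, rfl | rfl⟩ := Nat.even_or_odd' k
      · rw [momentIntegral_even]
        rcases Nat.eq_zero_or_pos j with rfl | hj
        · have h1 : momentIntegral (X ^ 0) = 1 := by simp [momentIntegral]
          rw [h1]
          refine tendsto_const_nhds.congr' ?_
          filter_upwards [(hG.tendsto_size h).eventually_gt_atTop 0] with n hn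
          rw [mul_zero, pow_zero, trace_one]
          exact (div_self hn.ne').symm
        · have h1 : P (X ^ j) := by
            rw [← hshift (X ^ j)]
            refine hcomp _ (j + 1) (by rw [hnd, natDegree_X_pow]; omega) fun i hi => ih i (by omega)
          simpa only [hP, map_pow, aeval_X, ← pow_mul] using h1
      · rw [momentIntegral_odd]
        refine tendsto_const_nhds.congr fun n => ?_
        have h1 := trace_mul_aeval_sq_eq_zero (sign_mul_sign _) (hG.refinement n).sign_mul_incl
          (X ^ j)
        rw [map_pow, aeval_X, ← pow_mul, ← pow_succ'] at h1
        rw [h1, zero_div]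
    obtain ⟨c, hc⟩ := hG.exists_abs_trace_pow_sub_le k
    simp only [hP]
    rw [← tendsto_add_atTop_iff_nat 1]
    have h1 := (hG.tendsto_size_ratio h).mul hN
    rw [one_mul] at h1
    have h2 : Tendsto (fun n => ((aeval ((G.refinement (n + 1)).incl ^ 2)
        ((X - C 2 : ℝ[X]) ^ k)).trace -
        2 * ((G.refinement n).incl ^ k).trace) / (G.refinement (n + 1)).size) atTop (𝓝 0) := by
      refine squeeze_zero_norm (fun n => ?_) (hs.const_div_atTop c)
      rw [norm_div, Real.norm_eq_abs, Real.norm_eq_abs, Nat.abs_cast]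
      exact div_le_div_of_nonneg_right (hc n) (Nat.cast_nonneg _)
    have h3 := h1.add h2
    rw [add_zero] at h3
    refine h3.congr' ?_
    filter_upwards [(hG.tendsto_size h).eventually_gt_atTop 0, hs.eventually_gt_atTop 0]
      with n hn hn1
    field_simp
    ring
  have := hcomp (p.comp (X + C 2)) (p.natDegree + 1) (by rw [hnd]; omega) fun i _ => hpow i
  rwa [hshift] at this

end FiniteComplex

/-! ### Convergence of the zeta functions -/

section Exponentials

/-- The function `λ ↦ λ^{-s}`, continued continuously below `1 / R`. -/
noncomputable def cutoffPow (R : ℝ) (s : ℂ) (y : ℝ) : ℂ :=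
  Complex.exp (-s * (Real.log (max y R⁻¹) : ℝ))

theorem continuous_cutoffPow {R : ℝ} (hR : 0 < R) (s : ℂ) : Continuous (cutoffPow R s) := by
  unfold cutoffPow
  have h1 : Continuous fun y : ℝ => Real.log (max y R⁻¹) :=
    Continuous.log (by fun_prop) fun y => (lt_max_of_lt_right (inv_pos.2 hR)).ne'
  fun_prop

theorem cpow_neg_eq_cutoffPow {R y : ℝ} (hR : 0 < R) (hy : R⁻¹ ≤ y) (s : ℂ) :
    (y : ℂ) ^ (-s) = cutoffPow R s y := by
  have hy0 : 0 < y := (inv_pos.2 hR).trans_le hy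
  rw [cutoffPow, max_eq_left hy, Complex.cpow_def_of_ne_zero (by exact_mod_cast hy0.ne'),
    Complex.ofReal_log hy0.le, mul_comm]

/-- A modulus of continuity in the exponent which does not depend on `y ≤ R`. -/
theorem norm_cutoffPow_sub_le {R y : ℝ} (hR : 1 ≤ R) (hy : y ≤ R) (s t : ℂ) :
    ‖cutoffPow R s y - cutoffPow R t y‖ ≤
      Real.exp (‖s‖ * Real.log R) * (Real.exp (‖t - s‖ * Real.log R) - 1) := by
  set ℓ : ℝ := Real.log (max y R⁻¹) with hℓ
  have hR0 : 0 < R := one_pos.trans_le hR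
  have hℓR : |ℓ| ≤ Real.log R := by
    rw [abs_le]
    have h0 : 0 < max y R⁻¹ := lt_max_of_lt_right (inv_pos.2 hR0)
    constructor
    · rw [← Real.log_inv]
      exact Real.log_le_log (inv_pos.2 hR0) (le_max_right _ _)
    · exact Real.log_le_log h0 (max_le hy ((inv_le_one_of_one_le₀ hR).trans hR))
  have hn : ∀ z : ℂ, ‖z * (ℓ : ℂ)‖ ≤ ‖z‖ * Real.log R := fun z => by
    rw [norm_mul, Complex.norm_real, Real.norm_eq_abs]
    gcongr
  have h1 : cutoffPow R s y - cutoffPow R t y =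
      -(Complex.exp (-s * ℓ) * (Complex.exp (-(t - s) * ℓ) - 1)) := by
    rw [cutoffPow, cutoffPow, ← hℓ, mul_sub, ← Complex.exp_add]
    ring_nf
  rw [h1, norm_neg, norm_mul]
  have h2 : ‖Complex.exp (-s * ℓ)‖ ≤ Real.exp (‖s‖ * Real.log R) := by
    refine (Complex.norm_exp_le_exp_norm _).trans (Real.exp_le_exp.2 ?_)
    simpa using hn (-s)
  have h3 : ‖Complex.exp (-(t - s) * ℓ) - 1‖ ≤ Real.exp (‖t - s‖ * Real.log R) - 1 := by
    have h4 := Complex.norm_exp_sub_sum_le_exp_norm_sub_sum (-(t - s) * ℓ) 1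
    simp only [Finset.range_one, Finset.sum_singleton, pow_zero, Nat.factorial_zero, Nat.cast_one,
      div_one] at h4
    refine h4.trans (sub_le_sub_right (Real.exp_le_exp.2 ?_) 1)
    have h5 := hn (-(t - s))
    rwa [norm_neg] at h5
  exact mul_le_mul h2 h3 (norm_nonneg _) (Real.exp_nonneg _)

theorem limitZeta_eq {R : ℝ} (hR : 25 ≤ R) (s : ℂ) :
    limitZeta s = (spectralIntegral (fun y => (cutoffPow R s y).re) : ℂ) +
      (spectralIntegral (fun y => (cutoffPow R s y).im) : ℂ) * Complex.I := by
  have hR0 : 0 < R := by linarith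
  have hc := continuous_cutoffPow hR0 s
  have hre : Continuous fun y => (cutoffPow R s y).re := Complex.continuous_re.comp hc
  have him : Continuous fun y => (cutoffPow R s y).im := Complex.continuous_im.comp hc
  rw [spectralIntegral, spectralIntegral, ← intervalIntegral.integral_ofReal,
    ← intervalIntegral.integral_ofReal, ← intervalIntegral.integral_mul_const,
    ← intervalIntegral.integral_add, limitZeta, ← intervalIntegral.integral_const_mul]
  · refine intervalIntegral.integral_congr fun x _ => ?_
    have h0 : 0 ≤ 4 * Real.sin (Real.pi * x) ^ 2 := by positivity
    have h4 : 4 * Real.sin (Real.pi * x) ^ 2 ≤ 4 := by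
      nlinarith [Real.sin_sq_le_one (Real.pi * x)]
    have h1 := fPlus_sq_mem_Icc h0 h4
    have h2 := fMinus_sq_mem_Icc h0 h4
    simp only [bigZ]
    set y := 4 * Real.sin (Real.pi * x) ^ 2 with hy
    have hR25 : R⁻¹ ≤ 25⁻¹ := inv_anti₀ (by norm_num) hR
    have hp : 0 < fPlus y ^ 2 := by linarith [h1.1]
    have hm : fMinus y ^ 2 = (fPlus y ^ 2)⁻¹ :=
      eq_inv_of_mul_eq_one_right (fPlus_sq_mul_fMinus_sq y)
    -- The two branches are inverse to each other: negating `s` exchanges the two terms.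
    have hcp : ((fPlus y ^ 2 : ℝ) : ℂ) ^ s = ((fMinus y ^ 2 : ℝ) : ℂ) ^ (-s) := by
      rw [hm, Complex.ofReal_inv, Complex.inv_cpow _ _ (by
        rw [Complex.arg_ofReal_of_nonneg hp.le]; exact Real.pi_pos.ne), Complex.cpow_neg, inv_inv]
    have hcm : ((fMinus y ^ 2 : ℝ) : ℂ) ^ s = ((fPlus y ^ 2 : ℝ) : ℂ) ^ (-s) := by
      rw [hm, Complex.ofReal_inv, Complex.inv_cpow _ _ (by
        rw [Complex.arg_ofReal_of_nonneg hp.le]; exact Real.pi_pos.ne), Complex.cpow_neg]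
    rw [hcp, hcm, cpow_neg_eq_cutoffPow hR0 (hR25.trans h2.1),
      cpow_neg_eq_cutoffPow hR0 (by linarith [h1.1, (by norm_num : (25⁻¹ : ℝ) ≤ 1)])]
    conv_lhs => rw [← Complex.re_add_im (cutoffPow R s (fPlus y ^ 2)),
      ← Complex.re_add_im (cutoffPow R s (fMinus y ^ 2))]
    push_cast
    ring
  all_goals apply Continuous.intervalIntegrable; fun_prop

theorem limitZeta_zero : limitZeta 0 = 1 := by
  simp [limitZeta, bigZ]
  norm_num

end Exponentials

namespace FiniteComplex
open Matrix Polynomial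
open scoped Matrix.Norms.Operator

variable {G : FiniteComplex.{u}}

/-- The eigenvalues of `L²`. -/
noncomputable def eig (G : FiniteComplex.{u}) : G.Simplex → ℝ :=
  G.isHermitian_connectionLaplacian_sq.eigenvalues

/-- A uniform spectral gap: both `L` and `L⁻¹ = L - N²` are bounded in terms of the maximal degree,
which does not grow under refinement. The bound `25` makes room for the limiting spectrum. -/
theorem DimLeOne.exists_eig_mem_Icc (hG : G.DimLeOne) :
    ∃ R : ℝ, 25 ≤ R ∧ ∀ n x, (G.refinement n).eig x ∈ Set.Icc R⁻¹ R := by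
  obtain ⟨Δ, hΔ2, hΔ⟩ := hG.exists_deg_refinement_le
  have hΔ2' : (2 : ℝ) ≤ Δ := by exact_mod_cast hΔ2
  set r : ℝ := 2 * Δ ^ 2 + Δ + 1 with hr
  have hr0 : 0 < r := by positivity
  have hr5 : 5 ≤ r := by nlinarith
  refine ⟨r ^ 2, by nlinarith, fun n => ?_⟩
  set G' := G.refinement n with hG'
  intro x
  have hG'1 : G'.DimLeOne := hG.refinement n
  have hN : ‖G'.incl‖ ≤ Δ := norm_incl_le (by linarith) fun x => by exact_mod_cast hΔ n x
  have hN2 : ‖G'.incl ^ 2‖ ≤ Δ ^ 2 := by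
    rw [pow_two, pow_two]
    exact (norm_mul_le _ _).trans (by gcongr)
  have h1 : ‖(1 : Matrix G'.Simplex G'.Simplex ℝ)‖ ≤ 1 := by
    rw [← diagonal_one, linfty_opNorm_diagonal, pi_norm_le_iff_of_nonneg zero_le_one]
    simp
  have hS := norm_sign_le G'
  have hL : ‖connectionForm G'.incl G'.sign‖ ≤ Δ + 1 + Δ ^ 2 := by
    have h2 : ‖(1 / 2 : ℝ) • ((1 - G'.sign) * G'.incl ^ 2)‖ ≤ Δ ^ 2 := by
      rw [norm_smul]
      calc ‖(1 / 2 : ℝ)‖ * ‖(1 - G'.sign) * G'.incl ^ 2‖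
          ≤ (1 / 2) * ((1 + 1) * Δ ^ 2) := by
            refine mul_le_mul (by norm_num) ?_ (norm_nonneg _) (by norm_num)
            refine (norm_mul_le _ _).trans ?_
            gcongr
            exact (norm_sub_le _ _).trans (add_le_add h1 hS)
        _ = Δ ^ 2 := by ring
    rw [connectionForm]
    exact (norm_add_le _ _).trans (add_le_add ((norm_add_le _ _).trans (add_le_add hN hS)) h2)
  have hsq : ∀ M : Matrix G'.Simplex G'.Simplex ℝ, ‖M‖ ≤ r → ‖M ^ 2‖ ≤ r ^ 2 := fun M hM => by
    rw [pow_two, pow_two]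
    exact (norm_mul_le _ _).trans (by gcongr)
  have hA : ‖G'.connectionLaplacian ^ 2‖ ≤ r ^ 2 := by
    rw [hG'1.connectionLaplacian_eq]
    exact hsq _ (hL.trans (by rw [hr]; nlinarith))
  have hB : ‖(connectionForm G'.incl G'.sign - G'.incl ^ 2) ^ 2‖ ≤ r ^ 2 :=
    hsq _ ((norm_sub_le _ _).trans ((add_le_add hL hN2).trans (by rw [hr]; linarith)))
  have hBA :
      (connectionForm G'.incl G'.sign - G'.incl ^ 2) ^ 2 * G'.connectionLaplacian ^ 2 = 1 := by
    rw [hG'1.connectionLaplacian_eq]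
    exact connectionForm_mul_inverse (sign_mul_sign _) hG'1.sign_mul_incl
  have hpos : 0 ≤ G'.eig x := by
    have hH : G'.connectionLaplacian.IsHermitian := by
      ext x y
      simp [connectionLaplacian, Finset.inter_comm]
    have hps : (G'.connectionLaplacian ^ 2).PosSemidef := by
      have h := posSemidef_conjTranspose_mul_self G'.connectionLaplacian
      rwa [hH.eq, ← pow_two] at h
    exact hps.eigenvalues_nonneg x
  have e1 := IsHermitian.abs_eigenvalues_le G'.isHermitian_connectionLaplacian_sq x
  have e2 := IsHermitian.one_le_norm_mul_abs_eigenvalues G'.isHermitian_connectionLaplacian_sq hBA x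
  change |G'.eig x| ≤ _ at e1
  change 1 ≤ _ * |G'.eig x| at e2
  rw [abs_of_nonneg hpos] at e1 e2
  refine ⟨?_, e1.trans hA⟩
  rw [inv_le_iff_one_le_mul₀ (by positivity)]
  calc 1 ≤ _ := e2
    _ ≤ r ^ 2 * G'.eig x := by gcongr
    _ = _ := mul_comm _ _

/-- The mean of a function over the eigenvalues of `L²`. -/
noncomputable def eigMean (G : FiniteComplex.{u}) (g : ℝ → ℝ) : ℝ := (∑ x, g (G.eig x)) / G.size

theorem DimLeOne.tendsto_eigMean_polynomial (hG : G.DimLeOne) (h : G.sign.trace < G.size)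
    (p : ℝ[X]) : Tendsto (fun n => (G.refinement n).eigMean fun y => p.eval y) atTop
      (𝓝 (spectralIntegral fun y => p.eval y)) := by
  induction p using Polynomial.induction_on' with
  | add p q hp hq =>
    simp only [eval_add, spectralIntegral_add p.continuous q.continuous]
    refine (hp.add hq).congr fun n => ?_
    rw [eigMean, eigMean, eigMean, Finset.sum_add_distrib, add_div]
  | monomial j c =>
    have hpow : Tendsto (fun n => (G.refinement n).eigMean fun y => y ^ j) atTop
        (𝓝 (spectralIntegral fun y => y ^ j)) := by
      rcases j with _ | j
      · have h1 : spectralIntegral (fun y => y ^ 0) = 1 := by simp [spectralIntegral]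
        rw [h1]
        refine tendsto_const_nhds.congr' ?_
        filter_upwards [(hG.tendsto_size h).eventually_gt_atTop 0] with n hn
        have : ∑ x : (G.refinement n).Simplex, (1 : ℝ) = (G.refinement n).size := by simp [size]
        simp only [eigMean, pow_zero, this]
        exact (div_self hn.ne').symm
      · rw [spectralIntegral_pow]
        have h1 := (hG.tendsto_trace_aeval_incl_sq h (meanPowPoly (2 * j + 1))).add
          ((hG.tendsto_size h).const_div_atTop
            ((fibPoly (2 * j + 1 + 1)).coeff 0 * G.sign.trace))
        rw [add_zero] at h1
        refine h1.congr fun n => ?_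
        have h2 := (G.refinement n).isHermitian_connectionLaplacian_sq.trace_aeval (X ^ (j + 1))
        change _ = ∑ i, eval ((G.refinement n).eig i) _ at h2
        rw [map_pow, aeval_X, ← pow_mul, (hG.refinement n).connectionLaplacian_eq,
          show 2 * (j + 1) = 2 * j + 1 + 1 by ring,
          trace_connectionForm_pow (sign_mul_sign _) (hG.refinement n).sign_mul_incl,
          hG.sign_trace_refinement] at h2
        rw [← add_div, h2]
        simp only [eval_pow, eval_X]
        rfl
    simp only [eval_monomial, spectralIntegral_const_mul]
    refine (hpow.const_mul c).congr fun n => ?_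
    rw [eigMean, eigMean, ← Finset.mul_sum, mul_div_assoc]

theorem abs_eigMean_sub_le {R ε : ℝ} (hG : ∀ x, G.eig x ∈ Set.Icc R⁻¹ R) (hs : 0 < (G.size : ℝ))
    {g h : ℝ → ℝ} (H : ∀ y ∈ Set.Icc R⁻¹ R, |g y - h y| ≤ ε) :
    |G.eigMean g - G.eigMean h| ≤ ε := by
  rw [eigMean, eigMean, ← sub_div, ← Finset.sum_sub_distrib, abs_div, abs_of_pos hs,
    div_le_iff₀ hs]
  refine (Finset.abs_sum_le_sum_abs _ _).trans
    ((Finset.sum_le_sum fun x _ => H _ (hG x)).trans (le_of_eq ?_))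
  simp [size, mul_comm]

/-- Equidistribution of the eigenvalues of `L²`, by Weierstrass approximation on an interval which
contains all of them. -/
theorem DimLeOne.tendsto_eigMean (hG : G.DimLeOne) (h : G.sign.trace < G.size) {g : ℝ → ℝ}
    (hg : Continuous g) : Tendsto (fun n => (G.refinement n).eigMean g) atTop
      (𝓝 (spectralIntegral g)) := by
  obtain ⟨R, hR, heig⟩ := hG.exists_eig_mem_Icc
  rw [Metric.tendsto_nhds]
  intro ε hε
  obtain ⟨p, hp⟩ := exists_polynomial_near_of_continuousOn R⁻¹ R g hg.continuousOn (ε / 4)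
    (by positivity)
  have hp' : ∀ y ∈ Set.Icc R⁻¹ R, |g y - p.eval y| ≤ ε / 4 := fun y hy => by
    rw [abs_sub_comm]; exact (hp y hy).le
  have hR25 : R⁻¹ ≤ 25⁻¹ := inv_anti₀ (by norm_num) hR
  have h1 := abs_le.1 (abs_spectralIntegral_sub_le hg p.continuous fun y hy =>
    hp' y ⟨hR25.trans hy.1, hy.2.trans hR⟩)
  filter_upwards [(hG.tendsto_size h).eventually_gt_atTop 0,
    Metric.tendsto_nhds.1 (hG.tendsto_eigMean_polynomial h p) (ε / 4) (by positivity)] with n hn hn2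
  have h2 := abs_le.1 (abs_eigMean_sub_le (heig n) hn hp')
  rw [Real.dist_eq, abs_lt] at hn2 ⊢
  constructor <;> linarith [h1.1, h1.2, h2.1, h2.2, hn2.1, hn2.2]

theorem DimLeOne.tendsto_zeta_div_size (hG : G.DimLeOne) (h : G.sign.trace < G.size) (s : ℂ) :
    Tendsto (fun n => (G.refinement n).zeta s / ((G.refinement n).size : ℂ)) atTop
      (𝓝 (limitZeta s)) := by
  obtain ⟨R, hR, heig⟩ := hG.exists_eig_mem_Icc
  have hR0 : 0 < R := by linarith
  have hc := continuous_cutoffPow hR0 s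
  have hre := hG.tendsto_eigMean h (Complex.continuous_re.comp hc)
  have him := hG.tendsto_eigMean h (Complex.continuous_im.comp hc)
  rw [limitZeta_eq hR]
  refine (((Complex.continuous_ofReal.tendsto _).comp hre).add
    (((Complex.continuous_ofReal.tendsto _).comp him).mul_const Complex.I)).congr fun n => ?_
  have h1 : (G.refinement n).zeta s = ∑ x, cutoffPow R s ((G.refinement n).eig x) :=
    Finset.sum_congr rfl fun x _ => cpow_neg_eq_cutoffPow hR0 (heig n x).1 s
  simp only [Function.comp_apply, eigMean]
  push_cast
  rw [h1, div_mul_eq_mul_div, ← add_div, Finset.sum_mul, ← Finset.sum_add_distrib]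
  simp only [Complex.re_add_im]

/-- The normalized zeta functions are equicontinuous, so pointwise convergence is uniform on compact
sets. -/
theorem DimLeOne.tendstoUniformlyOn_zeta_div_size (hG : G.DimLeOne) (h : G.sign.trace < G.size)
    {K : Set ℂ} (hK : IsCompact K) :
    TendstoUniformlyOn
      (fun (n : ℕ) (s : ℂ) => (G.refinement n).zeta s / ((G.refinement n).size : ℂ))
      limitZeta atTop K := by
  obtain ⟨R, hR, heig⟩ := hG.exists_eig_mem_Icc
  have hR0 : 0 < R := by linarith
  set F : ℕ → ℂ → ℂ := fun n s => (G.refinement n).zeta s / ((G.refinement n).size : ℂ) with hF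
  have heq : Equicontinuous F := by
    intro s
    refine Metric.equicontinuousAt_of_continuity_modulus
      (fun t => Real.exp (‖s‖ * Real.log R) * (Real.exp (‖t - s‖ * Real.log R) - 1)) ?_ F ?_
    · have hcont : Continuous fun t : ℂ =>
          Real.exp (‖s‖ * Real.log R) * (Real.exp (‖t - s‖ * Real.log R) - 1) := by fun_prop
      simpa using hcont.tendsto s
    · refine Eventually.of_forall fun t n => ?_
      have hzeta : ∀ s, (G.refinement n).zeta s = ∑ x, cutoffPow R s ((G.refinement n).eig x) :=
        fun s => Finset.sum_congr rfl fun x _ => cpow_neg_eq_cutoffPow hR0 (heig n x).1 s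
      set b := Real.exp (‖s‖ * Real.log R) * (Real.exp (‖t - s‖ * Real.log R) - 1) with hb
      have hb0 : 0 ≤ b := by
        have : 0 ≤ ‖t - s‖ * Real.log R :=
          mul_nonneg (norm_nonneg _) (Real.log_nonneg (by linarith))
        exact mul_nonneg (Real.exp_nonneg _) (sub_nonneg.2 (Real.one_le_exp this))
      rw [dist_eq_norm, hF]
      simp only
      rw [hzeta, hzeta, ← sub_div, ← Finset.sum_sub_distrib, norm_div, Complex.norm_natCast]
      refine div_le_of_le_mul₀ (Nat.cast_nonneg _) hb0 ?_
      refine (norm_sum_le _ _).trans ((Finset.sum_le_sum fun x _ =>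
        norm_cutoffPow_sub_le (by linarith) (heig n x).2 s t).trans (le_of_eq ?_))
      simp [size, mul_comm, hb]
  have hpt : Tendsto F atTop (𝓝 limitZeta) :=
    tendsto_pi_nhds.2 fun s => hG.tendsto_zeta_div_size h s
  have hunif := (EquicontinuousOn.tendsto_uniformOnFun_iff_pi (𝔖 := {K : Set ℂ | IsCompact K})
    (fun K hK => hK) (Set.eq_univ_of_forall fun s => ⟨{s}, isCompact_singleton, rfl⟩)
    (fun K _ => heq.equicontinuousOn K) atTop limitZeta).2 hpt
  exact (UniformOnFun.tendsto_iff_tendstoUniformlyOn.1 hunif) K hK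

theorem DimLeOne.eig_pos (hG : G.DimLeOne) (n : ℕ) (x : (G.refinement n).Simplex) :
    0 < (G.refinement n).eig x := by
  obtain ⟨R, hR, heig⟩ := hG.exists_eig_mem_Icc
  exact (inv_pos.2 (by linarith)).trans_le (heig n x).1

theorem DimLeOne.differentiable_zeta (hG : G.DimLeOne) (n : ℕ) :
    Differentiable ℂ (G.refinement n).zeta := by
  refine Differentiable.fun_sum fun x _ => ?_
  exact differentiable_id.neg.const_cpow (Or.inl (by exact_mod_cast (hG.eig_pos n x).ne'))

theorem nonempty_simplex_refinement (h : Nonempty G.Simplex) (n : ℕ) :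
    Nonempty (G.refinement n).Simplex := by
  induction n with
  | zero => exact h
  | succ n ih => rw [refinement_succ]; exact ih.map vtx

theorem zeta_zero (G : FiniteComplex.{u}) : G.zeta 0 = G.size := by
  simp [zeta, size]

end FiniteComplex

theorem mainTheorem4 (G : FiniteComplex.{u}) (hG : G.IsOneDimensional) :
    -- the limiting function is entire
    Differentiable ℂ limitZeta ∧
    -- the normalized zeta functions converge to it, uniformly on compact sets
    (∀ K : Set ℂ, IsCompact K →
      TendstoUniformlyOn
        (fun (n : ℕ) (s : ℂ) => (G.refinement n).zeta s / ((G.refinement n).size : ℂ))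
        limitZeta atTop K) ∧
    -- the zero-locus measures converge weakly (tested on compactly supported functions)
    (∀ φ : ℂ → ℝ, Continuous φ → HasCompactSupport φ →
      Tendsto (fun n : ℕ => ∫ w, φ w ∂(zeroLocusMeasure (G.refinement n).zeta)) atTop
        (𝓝 (∫ w, φ w ∂(zeroLocusMeasure limitZeta)))) ∧
    -- their restrictions to a compact set converge weakly if its boundary carries no limiting root
    (∀ K : Set ℂ, IsCompact K → (∀ w ∈ frontier K, limitZeta w ≠ 0) →
      ∀ φ : BoundedContinuousFunction ℂ ℝ,
        Tendsto (fun n : ℕ => ∫ w in K, φ w ∂(zeroLocusMeasure (G.refinement n).zeta)) atTop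
          (𝓝 (∫ w in K, φ w ∂(zeroLocusMeasure limitZeta)))) ∧
    -- a compact set away from the limiting roots finally contains no root at all
    (∀ K : Set ℂ, IsCompact K → (∀ w ∈ K, limitZeta w ≠ 0) →
      ∀ᶠ n : ℕ in atTop, zeroLocusMeasure (G.refinement n).zeta K = 0) := by
  have hG1 : G.DimLeOne := hG.1
  obtain ⟨x, hx, hx2⟩ := hG.2
  have hsize : G.sign.trace < G.size := FiniteComplex.sign_trace_lt_size (x := ⟨x, hx⟩) hx2
  have hpos : ∀ n, (G.refinement n).size ≠ 0 := by
    intro n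
    have := FiniteComplex.nonempty_simplex_refinement (G := G) ⟨⟨x, hx⟩⟩ n
    exact Fintype.card_ne_zero
  set F : ℕ → ℂ → ℂ := fun n s => (G.refinement n).zeta s / ((G.refinement n).size : ℂ) with hF
  have hunif : ∀ K : Set ℂ, IsCompact K → TendstoUniformlyOn F limitZeta atTop K :=
    fun K hK => hG1.tendstoUniformlyOn_zeta_div_size hsize hK
  have hloc : TendstoLocallyUniformlyOn F limitZeta atTop Set.univ :=
    (tendstoLocallyUniformlyOn_iff_forall_isCompact isOpen_univ).2 fun K _ hK => hunif K hK
  have hFd : ∀ n, Differentiable ℂ (F n) := fun n => (hG1.differentiable_zeta n).div_const _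
  have hlim : Differentiable ℂ limitZeta := differentiableOn_univ.1
    (hloc.differentiableOn (Eventually.of_forall fun n => (hFd n).differentiableOn) isOpen_univ)
  have hF0 : ∀ n, F n ≠ 0 := fun n h0 => by
    have h1 := congrFun h0 0
    simp [hF, FiniteComplex.zeta_zero, hpos n] at h1
  have hl0 : limitZeta ≠ 0 := fun h0 => by
    have h1 := congrFun h0 0
    simp [limitZeta_zero] at h1
  have hμ : ∀ n, zeroLocusMeasure (G.refinement n).zeta = zeroLocusMeasure (F n) := fun n => by
    have hc : ((G.refinement n).size : ℂ)⁻¹ ≠ 0 := inv_ne_zero (Nat.cast_ne_zero.2 (hpos n))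
    rw [← zeroLocusMeasure_const_mul (hG1.differentiable_zeta n) hc]
    congr 1
    ext s
    exact (div_eq_inv_mul _ _).symm
  simp only [hμ]
  refine ⟨hlim, hunif, fun φ hφ hs => ?_, fun K hK hfr φ => ?_, fun K hK h0 => ?_⟩
  · exact tendsto_integral_zeroLocusMeasure hFd hF0 hlim hl0 hloc hφ hs
  · exact tendsto_setIntegral_zeroLocusMeasure hFd hF0 hlim hl0 hloc hK hfr φ.continuous
  · filter_upwards [eventually_forall_ne_zero_of_isCompact hlim.continuous hK (hunif K hK) h0]
      with n hn
    exact zeroLocusMeasure_apply_eq_zero hK.measurableSet hn
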